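/- Let $P\subset\mathbb{R}^n$ be a polytope with non-empty interior. Facets and ridges of $P$ are its faces of dimension $n-1$ and $n-2$; the empty face has dimension $-1$. For a convex body $K\subset\mathbb{R}^n$ with non-empty interior let $X$ be uniformly distributed on $K$, let $A_K=\mathbb{E}[XX^{\mathsf T}]-\mathbb{E}[X]\,\mathbb{E}[X]^{\mathsf T}$, and let the isotropic constant $L_K\ge 0$ be given by $L_K^{2n}=\det A_K/(\operatorname{vol}K)^2$. Assume that $P$ is isotropic, that is, $\mathbb{E}[X]=0$ and $A_P=I_n$ for $X$ uniformly distributed on $P$. Assume that $K\mapsto L_K$ has a local extremum (a local maximum or a local minimum, with respect to the Hausdorff metric) at $P$ in the class of polytopes with non-empty interior in $\mathbb{R}^n$ that have at most as many facets as $P$. Assume finally that every ridge $G$ of $P$ is an affine reflector: if $F_1,F_2$ are the two facets of $P$ that contain $G$, there is an affine map $f\colon\mathbb{R}^n\to\mathbb{R}^n$ with $f(F_1)=F_2$ and $f(x)=x$ for all $x\in G$. Then for every ridge $G$ of $P$ the linear span of $G$ is a hyperplane, and $P$ is invariant under the orthogonal reflection across it. In particular, $P$ is isohedral: the group of isometries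 of $\mathbb{R}^n$ that map $P$ onto itself acts transitively on the facets of $P$. -/

import Mathlib

namespace PolytopeReflector

/-- Euclidean `n`-space `ℝⁿ`. -/
abbrev Space (n : ℕ) : Type := EuclideanSpace ℝ (Fin n)

/-- The uniform probability distribution on `K`: Lebesgue measure conditioned on `K`. -/
noncomputable def uniformDist {n : ℕ} (K : Set (Space n)) :
    MeasureTheory.Measure (Space n) :=
  ProbabilityTheory.cond MeasureTheory.volume K

/-- The centroid `E[X]`, where `X` is uniformly distributed on `K`. -/
noncomputable def centroid {n : ℕ} (K : Set (Space n)) : Space n :=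
  ∫ x, x ∂(uniformDist K)

/-- The covariance matrix `A_K = E[X Xᵀ] - E[X] E[X]ᵀ`, where `X` is uniformly distributed
on `K`. -/
noncomputable def covMatrix {n : ℕ} (K : Set (Space n)) : Matrix (Fin n) (Fin n) ℝ :=
  Matrix.of fun i j => (∫ x, x i * x j ∂(uniformDist K)) - centroid K i * centroid K j

/-- The isotropic constant `L_K`, given by `L_K ^ (2 n) = det A_K / (vol K) ^ 2`. -/
noncomputable def isotropicConstant {n : ℕ} (K : Set (Space n)) : ℝ :=
  ((covMatrix K).det / (MeasureTheory.volume.real K) ^ 2) ^ (1 / (2 * (n : ℝ)))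

/-- `K` is isotropic if `E[X] = 0` and `A_K = Iₙ`. -/
def IsIsotropic {n : ℕ} (K : Set (Space n)) : Prop :=
  centroid K = 0 ∧ covMatrix K = 1

/-- Polytopes with non-empty interior. -/
def IsPolytope {n : ℕ} (P : Set (Space n)) : Prop :=
  (∃ s : Set (Space n), s.Finite ∧ P = convexHull ℝ s) ∧ (interior P).Nonempty

open Classical in
/-- The dimension of (the affine hull of) a set, with `dim ∅ = -1`. -/
noncomputable def dim {n : ℕ} (s : Set (Space n)) : ℤ :=
  if s.Nonempty then (Module.finrank ℝ (vectorSpan ℝ s) : ℤ) else -1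

/-- `F` is a face of `P` of dimension `k`. The empty set is a face, of dimension `-1`. Every other
face is the set of maximizers on `P` of some linear functional. -/
def IsFaceOfDim {n : ℕ} (P F : Set (Space n)) (k : ℤ) : Prop :=
  IsExposed ℝ P F ∧ dim F = k

/-- Facets: the faces of dimension `n - 1`. -/
def IsFacet {n : ℕ} (P F : Set (Space n)) : Prop :=
  IsFaceOfDim P F ((n : ℤ) - 1)

/-- Ridges: the faces of dimension `n - 2`. -/
def IsRidge {n : ℕ} (P G : Set (Space n)) : Prop :=
  IsFaceOfDim P G ((n : ℤ) - 2)

/-- The number of facets of `P`. -/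
noncomputable def numFacets {n : ℕ} (P : Set (Space n)) : ℕ∞ :=
  {F : Set (Space n) | IsFacet P F}.encard

/-- A ridge `G` of `P` is an affine reflector if, `F₁` and `F₂` being the two facets that contain
`G`, some affine map `f` of `ℝⁿ` satisfies `f(F₁) = F₂` and fixes `G` pointwise. -/
def IsAffineReflector {n : ℕ} (P G : Set (Space n)) : Prop :=
  IsRidge P G ∧ ∃ F₁ F₂ : Set (Space n), IsFacet P F₁ ∧ IsFacet P F₂ ∧ F₁ ≠ F₂ ∧
    G ⊆ F₁ ∧ G ⊆ F₂ ∧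
    ∃ f : Space n →ᵃ[ℝ] Space n, f '' F₁ = F₂ ∧ ∀ x ∈ G, f x = x

/-- The polytope `P` is a local extremum (a local maximum or a local minimum), with respect to the
Hausdorff metric, of the isotropic constant on the class of polytopes with at most as many facets
as `P`. -/
def IsLocalExtremum {n : ℕ} (P : ConvexBody (Space n)) : Prop :=
  IsLocalExtrOn (fun K : ConvexBody (Space n) => isotropicConstant (K : Set (Space n)))
    {Q : ConvexBody (Space n) | IsPolytope (Q : Set (Space n)) ∧
      numFacets (Q : Set (Space n)) ≤ numFacets (P : Set (Space n))} P

/-- `P` is symmetric with respect to the linear hyperplane `H`: `H` is a linear subspace of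
dimension `n - 1`, and the orthogonal reflection across `H` maps `P` onto itself. -/
def IsSymmetricHyperplane {n : ℕ} (P : Set (Space n)) (H : Submodule ℝ (Space n)) : Prop :=
  Module.finrank ℝ H + 1 = n ∧ H.reflection '' P = P

/-- `P` is isohedral: its symmetry group (the Euclidean isometries of `ℝⁿ` mapping `P` onto itself)
acts transitively on its facets. -/
def IsIsohedral {n : ℕ} (P : Set (Space n)) : Prop :=
  ∀ F F' : Set (Space n), IsFacet P F → IsFacet P F' →
    ∃ g : Space n ≃ᵃⁱ[ℝ] Space n, g '' P = P ∧ g '' F = F'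

end PolytopeReflector

/-!
Why the theorem holds. Since the centroid of `P` is the origin, `P` is given by irredundant
inequalities `⟪u i, x⟫ ≤ 1` whose index set is in bijection with the facets. Replace one `u i` by
`u i + t • v`. The resulting polytopes have no more facets than `P` and converge to `P`, so the
derivative of the isotropic constant along them vanishes. For the pyramid `C i` with apex `0` over
the facet `i` this says that `∫ ‖x‖ ^ 2 * ⟪v, x⟫ = c * ∫ ⟪v, x⟫` over `C i`, for every vector `v` and
a constant `c` that depends on `n` only (`IsFacetSystem.integral_pyramid_eq`). The derivative is
computed by writing an integral over a polytope as an integral over the whole space of the tent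
function `max 0 (1 - gauge)` (`setIntegral_polyhedron_eq`), which can be differentiated under the
integral sign (`IsFacetSystem.hasDerivAt_setIntegral`).

Let an affine map fix a ridge and map the facet `i` to the facet `j`. Its restriction to the facet
extends to a linear map `T`, which maps `C i` onto `C j` and fixes the hyperplane spanned by the
ridge. Pulling the condition on `C j` back to `C i` shows that `‖T x‖ ^ 2 - ‖x‖ ^ 2`, which is a
product of two linear functionals one of which has constant sign on `C i`, is orthogonal to all
linear functionals on `C i`, hence zero. So `T` is the orthogonal reflection across the hyperplane
(`IsFacetSystem.reflection_image`).

A linear isometry that maps one facet of `P` to a facet maps neighbouring facets to facets, because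
the reflections at corresponding ridges are conjugate (`IsFacetSystem.exists_image_eq`). As the
facets are connected through ridges (`IsFacetSystem.forall_of_adjacent`, an argument from the
simplex method), the reflections preserve `P` and act transitively on the facets.
-/

open scoped InnerProductSpace Pointwise

namespace PolytopeReflector

variable {n : ℕ} {ι : Type*} {u : ι → Space n} {P : Set (Space n)}

/-! ### Polyhedra given by inequalities `⟪u i, x⟫ ≤ 1` -/

/-- The polyhedron `{x | ⟪u i, x⟫ ≤ 1 for all i}`. Every polytope with the origin in its interior
has this form, since the right hand sides can be normalized to `1`. -/
def polyhedron (u : ι → Space n) : Set (Space n) := {x | ∀ i, ⟪u i, x⟫_ℝ ≤ 1}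

/-- The face of `polyhedron u` on which the `i`-th inequality is an equality. -/
def polyFace (u : ι → Space n) (i : ι) : Set (Space n) :=
  {x | x ∈ polyhedron u ∧ ⟪u i, x⟫_ℝ = 1}

/-- The pyramid with base `polyFace u i` and apex `0`: the points of `polyhedron u` at which the
`i`-th functional is the largest one. -/
def pyramid (u : ι → Space n) (i : ι) : Set (Space n) :=
  {x | x ∈ polyhedron u ∧ ∀ j, ⟪u j, x⟫_ℝ ≤ ⟪u i, x⟫_ℝ}

lemma convex_halfSpace_inner_le (v : Space n) (r : ℝ) : Convex ℝ {x : Space n | ⟪v, x⟫_ℝ ≤ r} :=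
  convex_halfSpace_le (innerSL ℝ v).isLinear r

lemma convex_polyhedron (u : ι → Space n) : Convex ℝ (polyhedron u) := by
  have : polyhedron u = ⋂ i, {x : Space n | ⟪u i, x⟫_ℝ ≤ 1} := by
    ext x; simp [polyhedron]
  rw [this]
  exact convex_iInter fun i => convex_halfSpace_inner_le _ _

lemma isClosed_polyhedron (u : ι → Space n) : IsClosed (polyhedron u) := by
  have : polyhedron u = ⋂ i, {x : Space n | ⟪u i, x⟫_ℝ ≤ 1} := by
    ext x; simp [polyhedron]
  rw [this]
  exact isClosed_iInter fun i => isClosed_le (by fun_prop) (by fun_prop)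

lemma eventually_inner_add_smul_lt {y v w : Space n} (h : ⟪w, y⟫_ℝ < 1) :
    ∀ᶠ ε : ℝ in nhds 0, ⟪w, y + ε • v⟫_ℝ < 1 := by
  have : Continuous fun ε : ℝ => ⟪w, y + ε • v⟫_ℝ := by fun_prop
  exact this.tendsto' 0 ⟪w, y⟫_ℝ (by simp) |>.eventually_lt_const h

lemma polyhedron_mem_nhds_zero [Finite ι] (u : ι → Space n) : polyhedron u ∈ nhds 0 := by
  have h : ∀ᶠ x : Space n in nhds 0, ∀ i, ⟪u i, x⟫_ℝ < 1 := by
    rw [Filter.eventually_all]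
    intro i
    have : Continuous fun x : Space n => ⟪u i, x⟫_ℝ := by fun_prop
    exact this.tendsto' 0 0 (by simp) |>.eventually_lt_const one_pos
  filter_upwards [h] with x hx i using (hx i).le

lemma zero_mem_polyhedron (u : ι → Space n) : (0 : Space n) ∈ polyhedron u := by
  intro i; simp

/-- An extreme point of a polyhedron is determined by the set of inequalities that are equalities
there. -/
lemma finite_extremePoints_polyhedron [Finite ι] (u : ι → Space n) :
    ((polyhedron u).extremePoints ℝ).Finite := by
  refine Set.Finite.of_injOn (f := fun x => {i | ⟪u i, x⟫_ℝ = 1}) (t := Set.univ)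
    (Set.mapsTo_univ _ _) ?_ Set.finite_univ
  intro x hx y hy hxy
  have hev : ∀ᶠ ε : ℝ in nhds 0, x + ε • (x - y) ∈ polyhedron u := by
    change ∀ᶠ ε : ℝ in nhds 0, ∀ i, ⟪u i, x + ε • (x - y)⟫_ℝ ≤ 1
    rw [Filter.eventually_all]
    intro i
    by_cases hi : ⟪u i, x⟫_ℝ = 1
    · have hi' : ⟪u i, y⟫_ℝ = 1 := by
        have : i ∈ {i | ⟪u i, x⟫_ℝ = 1} := hi
        have hxy' : {i | ⟪u i, x⟫_ℝ = 1} = {i | ⟪u i, y⟫_ℝ = 1} := hxy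
        rw [hxy'] at this
        exact this
      refine Filter.Eventually.of_forall fun ε => ?_
      rw [inner_add_right, inner_smul_right, inner_sub_right, hi, hi']
      simp
    · have : ⟪u i, x⟫_ℝ < 1 := lt_of_le_of_ne (hx.1 i) hi
      filter_upwards [eventually_inner_add_smul_lt (v := x - y) this] with ε h using h.le
  obtain ⟨ε, hε, hε0⟩ := ((hev.filter_mono nhdsWithin_le_nhds).and
    (self_mem_nhdsWithin : Set.Ioi (0 : ℝ) ∈ nhdsWithin 0 (Set.Ioi 0))).exists
  have hε0 : 0 < ε := hε0
  have := hx.2 hy.1 hε ?_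
  · exact this.symm
  · refine ⟨ε / (1 + ε), 1 / (1 + ε), by positivity, by positivity, by field_simp; ring, ?_⟩
    have h1 : (1 + ε) ≠ 0 := by positivity
    have h2 : (1 + ε) • ((ε / (1 + ε)) • y + (1 / (1 + ε)) • (x + ε • (x - y))) = (1 + ε) • x := by
      rw [smul_add, smul_smul, smul_smul, mul_div_cancel₀ _ h1, mul_div_cancel₀ _ h1]
      module
    exact smul_right_injective _ h1 h2

lemma closedConvexHull_extremePoints_polyhedron {u : ι → Space n}
    (hb : Bornology.IsBounded (polyhedron u)) :
    closure (convexHull ℝ ((polyhedron u).extremePoints ℝ)) = polyhedron u :=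
  closure_convexHull_extremePoints
    (Metric.isCompact_of_isClosed_isBounded (isClosed_polyhedron u) hb) (convex_polyhedron u)

lemma isPolytope_polyhedron [Finite ι] {u : ι → Space n}
    (hb : Bornology.IsBounded (polyhedron u)) : IsPolytope (polyhedron u) := by
  refine ⟨⟨_, finite_extremePoints_polyhedron u, ?_⟩,
    ⟨0, mem_interior_iff_mem_nhds.2 (polyhedron_mem_nhds_zero u)⟩⟩
  conv_lhs => rw [← closedConvexHull_extremePoints_polyhedron hb]
  exact ((finite_extremePoints_polyhedron u).isCompact_convexHull ℝ).isClosed.closure_eq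

/-- The half-space description of a polytope with the origin in its interior. The functionals are
the vertices of the polar polytope. -/
lemma exists_finset_halfSpaces {P : Set (Space n)} (hP : IsPolytope P)
    (h0 : (0 : Space n) ∈ interior P) :
    ∃ U : Finset (Space n), P = {x | ∀ v ∈ U, ⟪v, x⟫_ℝ ≤ 1} := by
  obtain ⟨⟨s, hs, rfl⟩, -⟩ := hP
  have : Finite s := hs
  set w : s → Space n := fun v => v
  have hpol : ∀ v ∈ polyhedron w, ∀ x ∈ convexHull ℝ s, ⟪v, x⟫_ℝ ≤ 1 := by
    intro v hv x hx
    have : convexHull ℝ s ⊆ {x : Space n | ⟪v, x⟫_ℝ ≤ 1} := by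
      refine convexHull_min ?_ (convex_halfSpace_inner_le _ _)
      intro x hx
      change ⟪v, x⟫_ℝ ≤ 1
      rw [real_inner_comm]
      exact hv ⟨x, hx⟩
    exact this hx
  have hb : Bornology.IsBounded (polyhedron w) := by
    obtain ⟨r, hr, hball⟩ := Metric.mem_nhds_iff.1 (mem_interior_iff_mem_nhds.1 h0)
    refine isBounded_iff_forall_norm_le.2 ⟨2 / r, fun v hv => ?_⟩
    by_cases hv0 : v = 0
    · subst hv0; simp; positivity
    have hn : 0 < ‖v‖ := norm_pos_iff.2 hv0
    have := hpol v hv ((r / 2 / ‖v‖) • v) (hball (by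
      rw [mem_ball_zero_iff, norm_smul, Real.norm_of_nonneg (by positivity)]
      field_simp; linarith))
    rw [inner_smul_right, real_inner_self_eq_norm_sq] at this
    rw [le_div_iff₀ hr]
    field_simp at this
    linarith
  have hfin := finite_extremePoints_polyhedron w
  refine ⟨hfin.toFinset, Set.Subset.antisymm ?_ ?_⟩
  · intro x hx v hv
    rw [Set.Finite.mem_toFinset] at hv
    exact hpol v hv.1 x hx
  · intro x hx
    have hx' : ∀ v ∈ polyhedron w, ⟪v, x⟫_ℝ ≤ 1 := by
      intro v hv
      rw [← closedConvexHull_extremePoints_polyhedron hb] at hv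
      have : closure (convexHull ℝ ((polyhedron w).extremePoints ℝ)) ⊆
          {v : Space n | ⟪v, x⟫_ℝ ≤ 1} := by
        refine closure_minimal (convexHull_min ?_ ?_) (isClosed_le (by fun_prop) (by fun_prop))
        · intro v hv
          exact hx v (hfin.mem_toFinset.2 hv)
        · simpa only [real_inner_comm] using convex_halfSpace_inner_le x 1
      exact this hv
    by_contra hxP
    obtain ⟨f, c, hf, hc⟩ := geometric_hahn_banach_closed_point (convex_convexHull ℝ s)
      (hs.isCompact_convexHull ℝ).isClosed hxP
    have hc0 : 0 < c := by simpa using hf 0 (interior_subset h0)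
    set v : Space n := (InnerProductSpace.toDual ℝ (Space n)).symm f
    have hv : ∀ y, ⟪v, y⟫_ℝ = f y := fun y => InnerProductSpace.toDual_symm_apply
    have := hx' (c⁻¹ • v) (by
      rintro ⟨y, hy⟩
      change ⟪y, c⁻¹ • v⟫_ℝ ≤ 1
      rw [real_inner_comm, real_inner_smul_left, hv, inv_mul_le_iff₀ hc0, mul_one]
      exact (hf y (subset_convexHull ℝ s hy)).le)
    rw [real_inner_smul_left, hv, inv_mul_le_iff₀ hc0] at this
    linarith

/-! ### Irredundant systems of inequalities -/

/-- A convex set cut out of `E` by a finite system of inequalities is cut out by a subsystem in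
which no inequality is redundant, so that each one is the only equality at some point. -/
lemma exists_irredundant {E : Set (Space n)} (hE : Convex ℝ E) {p : Space n} (hp : p ∈ E)
    (S : Finset ι) (u : ι → Space n) (hS : ∀ j ∈ S, ⟪u j, p⟫_ℝ < 1) :
    ∃ J ⊆ S, (∀ x ∈ E, (∀ j ∈ J, ⟪u j, x⟫_ℝ ≤ 1) → ∀ j ∈ S, ⟪u j, x⟫_ℝ ≤ 1) ∧
      ∀ j ∈ J, ∃ y ∈ E, ⟪u j, y⟫_ℝ = 1 ∧ ∀ k ∈ J, k ≠ j → ⟪u k, y⟫_ℝ < 1 := by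
  classical
  induction S using Finset.strongInduction with
  | H S ih =>
  by_cases hred : ∃ i ∈ S, ∀ x ∈ E, (∀ j ∈ S.erase i, ⟪u j, x⟫_ℝ ≤ 1) → ⟪u i, x⟫_ℝ ≤ 1
  · obtain ⟨i, hi, hred⟩ := hred
    obtain ⟨J, hJ, h1, h2⟩ := ih (S.erase i) (Finset.erase_ssubset hi)
      (fun j hj => hS j (Finset.mem_of_mem_erase hj))
    refine ⟨J, hJ.trans (Finset.erase_subset _ _), fun x hx hxJ j hj => ?_, h2⟩
    by_cases hji : j = i
    · subst hji; exact hred x hx (h1 x hx hxJ)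
    · exact h1 x hx hxJ j (Finset.mem_erase.2 ⟨hji, hj⟩)
  · push Not at hred
    refine ⟨S, subset_rfl, fun x _ h => h, fun i hi => ?_⟩
    obtain ⟨x, hx, hxS, hxi⟩ := hred i hi
    -- the segment from `p` to `x` leaves the half-space `i` at the parameter `t`
    have hpi := hS i hi
    set a := ⟪u i, p⟫_ℝ
    set b := ⟪u i, x⟫_ℝ
    have hba : 0 < b - a := by linarith
    set t := (1 - a) / (b - a)
    have ht0 : 0 < t := div_pos (by linarith) hba
    have ht1 : t < 1 := (div_lt_one hba).2 (by linarith)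
    have hin : ∀ j, ⟪u j, (1 - t) • p + t • x⟫_ℝ = (1 - t) * ⟪u j, p⟫_ℝ + t * ⟪u j, x⟫_ℝ := by
      intro j; rw [inner_add_right, inner_smul_right, inner_smul_right]
    refine ⟨(1 - t) • p + t • x, hE hp hx (by linarith) ht0.le (by ring), ?_, ?_⟩
    · rw [hin]
      have : t * (b - a) = 1 - a := div_mul_cancel₀ _ hba.ne'
      change (1 - t) * a + t * b = 1
      linarith
    · intro k hk hki
      rw [hin]
      have h1 := hS k hk
      have h2 := hxS k (Finset.mem_erase.2 ⟨hki, hk⟩)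
      nlinarith

/-- `u` describes the polytope `P` by normalized inequalities, none of which is redundant: each
inequality is the only equality at some point. -/
structure IsFacetSystem (u : ι → Space n) (P : Set (Space n)) : Prop where
  eq : polyhedron u = P
  bdd : Bornology.IsBounded (polyhedron u)
  exists_strict : ∀ i, ∃ y, ⟪u i, y⟫_ℝ = 1 ∧ ∀ j, j ≠ i → ⟪u j, y⟫_ℝ < 1

lemma exists_isFacetSystem {P : Set (Space n)} (hP : IsPolytope P)
    (h0 : (0 : Space n) ∈ interior P) :
    ∃ (J : Finset (Space n)), IsFacetSystem (fun v : J => (v : Space n)) P := by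
  obtain ⟨U, hU⟩ := exists_finset_halfSpaces hP h0
  obtain ⟨J, hJ, h1, h2⟩ := exists_irredundant (E := Set.univ) convex_univ (Set.mem_univ 0) U id
    (by simp)
  have heq : polyhedron (fun v : J => (v : Space n)) = P := by
    ext x
    rw [hU]
    constructor
    · intro hx v hv
      exact h1 x (Set.mem_univ _) (fun j hj => hx ⟨j, hj⟩) v hv
    · intro hx v
      exact hx v (hJ v.2)
  refine ⟨J, heq, ?_, ?_⟩
  · rw [heq]
    obtain ⟨⟨s, hs, rfl⟩, -⟩ := hP
    exact (hs.isCompact_convexHull ℝ).isBounded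
  · rintro ⟨v, hv⟩
    obtain ⟨y, -, hy1, hy2⟩ := h2 v hv
    exact ⟨y, hy1, fun w hw => hy2 w w.2 (fun h => hw (Subtype.ext h))⟩

/-! ### Facets and ridges in terms of the inequalities -/

lemma neg_one_le_dim (S : Set (Space n)) : -1 ≤ dim S := by
  unfold dim
  split_ifs
  · exact le_trans (by norm_num) (Int.natCast_nonneg _)
  · exact le_rfl

lemma eq_empty_of_dim_eq_neg_one {S : Set (Space n)} (hS : dim S = -1) : S = ∅ := by
  by_contra hne
  rw [dim, if_pos (Set.nonempty_iff_ne_empty.2 hne)] at hS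
  have := Int.natCast_nonneg (Module.finrank ℝ (vectorSpan ℝ S))
  omega

lemma exists_forall_inner_lt_one {C : Set (Space n)} (hC : Convex ℝ C) (hne : C.Nonempty)
    (u : ι → Space n) (S : Finset ι) (hle : ∀ x ∈ C, ∀ j ∈ S, ⟪u j, x⟫_ℝ ≤ 1)
    (hlt : ∀ j ∈ S, ∃ x ∈ C, ⟪u j, x⟫_ℝ < 1) :
    ∃ y ∈ C, ∀ j ∈ S, ⟪u j, y⟫_ℝ < 1 := by
  classical
  induction S using Finset.induction_on with
  | empty => exact ⟨hne.some, hne.some_mem, by simp⟩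
  | insert a S ha ih =>
    obtain ⟨y, hy, hyS⟩ := ih (fun x hx j hj => hle x hx j (Finset.mem_insert_of_mem hj))
      (fun j hj => hlt j (Finset.mem_insert_of_mem hj))
    obtain ⟨x, hx, hxa⟩ := hlt a (Finset.mem_insert_self _ _)
    refine ⟨(1 / 2 : ℝ) • y + (1 / 2 : ℝ) • x,
      hC hy hx (by norm_num) (by norm_num) (by norm_num), ?_⟩
    intro j hj
    rw [inner_add_right, inner_smul_right, inner_smul_right]
    rcases Finset.mem_insert.1 hj with rfl | hj'
    · linarith [hle y hy j hj]
    · linarith [hyS j hj', hle x hx j hj]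

lemma finrank_orthogonal_singleton {v : Space n} (hv : v ≠ 0) :
    Module.finrank ℝ (ℝ ∙ v)ᗮ + 1 = n := by
  have h := Submodule.finrank_add_finrank_orthogonal (ℝ ∙ v)
  rw [finrank_span_singleton hv, finrank_euclideanSpace_fin] at h
  omega

lemma mem_orthogonal_sub_iff {v w x : Space n} :
    x ∈ (ℝ ∙ (v - w))ᗮ ↔ ⟪v, x⟫_ℝ = ⟪w, x⟫_ℝ := by
  rw [Submodule.mem_orthogonal_singleton_iff_inner_right, inner_sub_left, sub_eq_zero]

/-- The linear span of a set in an affine hyperplane that misses the origin has one dimension more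
than the set; the convention `dim ∅ = -1` fits. -/
lemma finrank_span_eq_dim_add_one {S : Set (Space n)} {v : Space n}
    (hS : ∀ x ∈ S, ⟪v, x⟫_ℝ = 1) : (Module.finrank ℝ (Submodule.span ℝ S) : ℤ) = dim S + 1 := by
  rcases S.eq_empty_or_nonempty with rfl | ⟨g, hg⟩
  · simp [dim]
  rw [dim, if_pos ⟨g, hg⟩]
  have hg0 : g ≠ 0 := by
    rintro rfl
    simpa using hS 0 hg
  have hker : vectorSpan ℝ S ≤ (ℝ ∙ v)ᗮ := by
    rw [vectorSpan, Submodule.span_le]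
    rintro _ ⟨x, hx, y, hy, rfl⟩
    change x - y ∈ (ℝ ∙ v)ᗮ
    rw [Submodule.mem_orthogonal_singleton_iff_inner_right, inner_sub_right, hS x hx,
      hS y hy, sub_self]
  have hsup : vectorSpan ℝ S ⊔ ℝ ∙ g = Submodule.span ℝ S := by
    refine le_antisymm (sup_le ?_ ?_) ?_
    · rw [vectorSpan, Submodule.span_le]
      rintro _ ⟨x, hx, y, hy, rfl⟩
      exact Submodule.sub_mem _ (Submodule.subset_span hx) (Submodule.subset_span hy)
    · rw [Submodule.span_singleton_le_iff_mem]
      exact Submodule.subset_span hg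
    · rw [Submodule.span_le]
      intro x hx
      have : x = (x - g) + g := by abel
      rw [this]
      exact Submodule.add_mem_sup (vsub_mem_vectorSpan ℝ hx hg)
        (Submodule.mem_span_singleton_self g)
  have hinf : vectorSpan ℝ S ⊓ ℝ ∙ g = ⊥ := by
    rw [eq_bot_iff]
    rintro x ⟨hx1, hx2⟩
    obtain ⟨c, rfl⟩ := Submodule.mem_span_singleton.1 hx2
    have := hker hx1
    rw [Submodule.mem_orthogonal_singleton_iff_inner_right, inner_smul_right, hS g hg,
      mul_one] at this
    simp [this]
  have h := Submodule.finrank_sup_add_finrank_inf_eq (vectorSpan ℝ S) (ℝ ∙ g)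
  rw [hsup, hinf, finrank_bot, finrank_span_singleton hg0] at h
  omega

lemma le_span_of_forall_eventually {S : Set (Space n)} {v y : Space n} {L : Submodule ℝ (Space n)}
    (hyS : y ∈ S) (hyL : y ∈ L) (hvy : ⟪v, y⟫_ℝ = 1)
    (h : ∀ x ∈ L, ⟪v, x⟫_ℝ = 0 → ∀ᶠ ε : ℝ in nhds 0, y + ε • x ∈ S) :
    L ≤ Submodule.span ℝ S := by
  intro x hx
  set z := x - ⟪v, x⟫_ℝ • y with hz
  have hzL : z ∈ L := L.sub_mem hx (L.smul_mem _ hyL)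
  have hvz : ⟪v, z⟫_ℝ = 0 := by
    rw [hz, inner_sub_right, inner_smul_right, hvy]; ring
  obtain ⟨ε, hε, hε0⟩ := (((h z hzL hvz).filter_mono nhdsWithin_le_nhds).and
    (self_mem_nhdsWithin : Set.Ioi (0 : ℝ) ∈ nhdsWithin 0 (Set.Ioi 0))).exists
  have hε0 : ε ≠ 0 := ne_of_gt hε0
  have hzs : z ∈ Submodule.span ℝ S := by
    have : z = ε⁻¹ • ((y + ε • z) - y) := by
      rw [add_sub_cancel_left, smul_smul, inv_mul_cancel₀ hε0, one_smul]
    rw [this]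
    exact Submodule.smul_mem _ _
      (Submodule.sub_mem _ (Submodule.subset_span hε) (Submodule.subset_span hyS))
  have : x = z + ⟪v, x⟫_ℝ • y := by rw [hz]; abel
  rw [this]
  exact Submodule.add_mem _ hzs (Submodule.smul_mem _ _ (Submodule.subset_span hyS))

lemma isExposed_polyFace (u : ι → Space n) (i : ι) : IsExposed ℝ (polyhedron u) (polyFace u i) := by
  rintro ⟨z, hz, hzi⟩
  refine ⟨innerSL ℝ (u i), Set.ext fun x => ⟨?_, ?_⟩⟩
  · rintro ⟨hx, hxi⟩
    refine ⟨hx, fun y hy => ?_⟩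
    rw [innerSL_apply_apply, innerSL_apply_apply, hxi]
    exact hy i
  · rintro ⟨hx, hxi⟩
    have := hxi z hz
    rw [innerSL_apply_apply, innerSL_apply_apply, hzi] at this
    exact ⟨hx, le_antisymm (hx i) this⟩

lemma vectorSpan_polyhedron [Finite ι] (u : ι → Space n) : vectorSpan ℝ (polyhedron u) = ⊤ := by
  rw [eq_top_iff]
  intro x _
  have : Filter.Tendsto (fun ε : ℝ => ε • x) (nhds 0) (nhds 0) :=
    (by fun_prop : Continuous fun ε : ℝ => ε • x).tendsto' 0 0 (by simp)
  obtain ⟨ε, hε, hε0⟩ := (((this.eventually (polyhedron_mem_nhds_zero u)).filter_mono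
    nhdsWithin_le_nhds).and
    (self_mem_nhdsWithin : Set.Ioi (0 : ℝ) ∈ nhdsWithin 0 (Set.Ioi 0))).exists
  have hε0 : ε ≠ 0 := ne_of_gt hε0
  have h := vsub_mem_vectorSpan ℝ (show ε • x ∈ polyhedron u from hε) (zero_mem_polyhedron u)
  rw [vsub_eq_sub, sub_zero] at h
  have := Submodule.smul_mem _ ε⁻¹ h
  rwa [smul_smul, inv_mul_cancel₀ hε0, one_smul] at this

/-- Every facet of a polyhedron is cut out by one of its inequalities. -/
lemma exists_eq_polyFace_of_isFacet [Fintype ι] (hn : n ≠ 0) {u : ι → Space n} {F : Set (Space n)}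
    (hF : IsFacet (polyhedron u) F) : ∃ j, F = polyFace u j := by
  obtain ⟨hexp, hdim⟩ := hF
  have hne : F.Nonempty := by
    by_contra h
    rw [dim, if_neg h] at hdim
    omega
  have hconv : Convex ℝ F := hexp.convex (convex_polyhedron u)
  obtain ⟨l, hl⟩ := hexp hne
  have hsub : F ⊆ polyhedron u := by rw [hl]; exact fun x hx => hx.1
  have hj : ∃ j, ∀ x ∈ F, ⟪u j, x⟫_ℝ = 1 := by
    by_contra! hcon
    obtain ⟨y, hyF, hy⟩ := exists_forall_inner_lt_one hconv hne u Finset.univ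
      (fun x hx j _ => hsub hx j)
      (fun j _ => by
        obtain ⟨x, hx, hxj⟩ := hcon j
        exact ⟨x, hx, lt_of_le_of_ne (hsub hx j) hxj⟩)
    -- a functional with an interior maximum vanishes
    have hl0 : ∀ v, l v ≤ 0 := by
      intro v
      have hev : ∀ᶠ ε : ℝ in nhds 0, ∀ j, ⟪u j, y + ε • v⟫_ℝ < 1 := by
        rw [Filter.eventually_all]
        exact fun j => eventually_inner_add_smul_lt (hy j (Finset.mem_univ j))
      obtain ⟨ε, hε, hε0⟩ := ((hev.filter_mono nhdsWithin_le_nhds).and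
        (self_mem_nhdsWithin : Set.Ioi (0 : ℝ) ∈ nhdsWithin 0 (Set.Ioi 0))).exists
      have hε0 : 0 < ε := hε0
      rw [hl] at hyF
      have := hyF.2 (y + ε • v) (fun j => (hε j).le)
      rw [map_add, map_smul, smul_eq_mul] at this
      nlinarith
    have hFP : F = polyhedron u := by
      refine hsub.antisymm fun x hx => ?_
      rw [hl]
      refine ⟨hx, fun z _ => ?_⟩
      have h1 := hl0 z
      have h2 := hl0 (-x)
      rw [map_neg] at h2
      linarith
    rw [hFP, dim, if_pos ⟨0, zero_mem_polyhedron u⟩, vectorSpan_polyhedron, finrank_top,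
      finrank_euclideanSpace_fin] at hdim
    omega
  obtain ⟨j, hj⟩ := hj
  refine ⟨j, Set.Subset.antisymm (fun x hx => ⟨hsub hx, hj x hx⟩) ?_⟩
  have hspan : Submodule.span ℝ F = ⊤ := by
    apply Submodule.eq_top_of_finrank_eq
    have := finrank_span_eq_dim_add_one hj
    rw [hdim] at this
    rw [finrank_euclideanSpace_fin]
    omega
  obtain ⟨z, hz⟩ := hne
  have hlz : ∀ x ∈ F, l x = l z := by
    intro x hx
    have hx' := hx
    rw [hl] at hx hz
    exact le_antisymm (hz.2 x hx.1) (hx.2 z hz.1)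
  have hlin : ∀ x, l x = l z * ⟪u j, x⟫_ℝ := by
    intro x
    have hx : x ∈ Submodule.span ℝ F := hspan ▸ Submodule.mem_top
    induction hx using Submodule.span_induction with
    | mem x hx => rw [hlz x hx, hj x hx, mul_one]
    | zero => simp
    | add x y _ _ hx hy => rw [map_add, inner_add_right, hx, hy]; ring
    | smul c x _ hx => rw [map_smul, inner_smul_right, hx, smul_eq_mul]; ring
  intro x hx
  rw [hl] at hz ⊢
  refine ⟨hx.1, fun y hy => ?_⟩
  rw [hlin x, hx.2, mul_one]
  exact hz.2 y hy

lemma numFacets_polyhedron_le [Fintype ι] (hn : n ≠ 0) (u : ι → Space n) :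
    numFacets (polyhedron u) ≤ Fintype.card ι := by
  have hsub : {F : Set (Space n) | IsFacet (polyhedron u) F} ⊆ (polyFace u) '' Set.univ := by
    intro F hF
    obtain ⟨j, rfl⟩ := exists_eq_polyFace_of_isFacet hn hF
    exact ⟨j, Set.mem_univ _, rfl⟩
  calc numFacets (polyhedron u) ≤ ((polyFace u) '' Set.univ).encard := Set.encard_le_encard hsub
    _ ≤ (Set.univ : Set ι).encard := Set.encard_image_le _ _
    _ = Fintype.card ι := by rw [Set.encard_univ, ENat.card_eq_coe_fintype_card]

namespace IsFacetSystem

lemma exists_mem_polyFace (h : IsFacetSystem u P) (i : ι) :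
    ∃ y ∈ polyFace u i, ∀ j, j ≠ i → ⟪u j, y⟫_ℝ < 1 := by
  obtain ⟨y, hy, hy'⟩ := h.exists_strict i
  refine ⟨y, ⟨fun j => ?_, hy⟩, hy'⟩
  by_cases hj : j = i
  · rw [hj, hy]
  · exact (hy' j hj).le

lemma ne (h : IsFacetSystem u P) {i j : ι} (hij : i ≠ j) : u i ≠ u j := by
  intro he
  obtain ⟨y, hy, hy'⟩ := h.exists_strict i
  have := hy' j hij.symm
  rw [← he, hy] at this
  exact lt_irrefl _ this

lemma ne_zero (h : IsFacetSystem u P) (i : ι) : u i ≠ 0 := by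
  intro he
  obtain ⟨y, hy, hy'⟩ := h.exists_strict i
  rw [he, inner_zero_left] at hy
  exact zero_ne_one hy

lemma polyFace_injective (h : IsFacetSystem u P) : Function.Injective (polyFace u) := by
  intro i j hij
  by_contra hne
  obtain ⟨y, hy, hy'⟩ := h.exists_mem_polyFace i
  rw [hij] at hy
  exact absurd hy.2 (hy' j (Ne.symm hne)).ne

lemma span_polyFace [Finite ι] (h : IsFacetSystem u P) (i : ι) :
    Submodule.span ℝ (polyFace u i) = ⊤ := by
  obtain ⟨y, hy, hy'⟩ := h.exists_mem_polyFace i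
  rw [eq_top_iff]
  refine le_span_of_forall_eventually hy Submodule.mem_top hy.2 fun x _ hx => ?_
  have hev : ∀ᶠ ε : ℝ in nhds 0, ∀ j, j ≠ i → ⟪u j, y + ε • x⟫_ℝ < 1 := by
    rw [Filter.eventually_all]
    intro j
    by_cases hj : j = i
    · simp [hj]
    · filter_upwards [eventually_inner_add_smul_lt (v := x) (hy' j hj)] with ε hε _ using hε
  filter_upwards [hev] with ε hε
  have hi : ⟪u i, y + ε • x⟫_ℝ = 1 := by rw [inner_add_right, inner_smul_right, hx, hy.2]; ring
  refine ⟨fun j => ?_, hi⟩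
  by_cases hj : j = i
  · rw [hj, hi]
  · exact (hε j hj).le

lemma isFacet_polyFace [Finite ι] (h : IsFacetSystem u P) (i : ι) : IsFacet P (polyFace u i) := by
  refine ⟨h.eq ▸ isExposed_polyFace u i, ?_⟩
  have := finrank_span_eq_dim_add_one (S := polyFace u i) (v := u i) (fun x hx => hx.2)
  rw [h.span_polyFace, finrank_top, finrank_euclideanSpace_fin] at this
  omega

lemma isFacet_iff [Fintype ι] (h : IsFacetSystem u P) (hn : n ≠ 0) {F : Set (Space n)} :
    IsFacet P F ↔ ∃ i, F = polyFace u i := by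
  constructor
  · intro hF
    rw [← h.eq] at hF
    exact exists_eq_polyFace_of_isFacet hn hF
  · rintro ⟨i, rfl⟩
    exact h.isFacet_polyFace i

lemma card_le_numFacets [Fintype ι] (h : IsFacetSystem u P) :
    (Fintype.card ι : ℕ∞) ≤ numFacets P := by
  have hsub : (polyFace u) '' Set.univ ⊆ {F : Set (Space n) | IsFacet P F} := by
    rintro _ ⟨i, -, rfl⟩
    exact h.isFacet_polyFace i
  refine le_trans (le_of_eq ?_) (Set.encard_le_encard hsub)
  rw [h.polyFace_injective.encard_image, Set.encard_univ, ENat.card_eq_coe_fintype_card]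

lemma span_inter_le (u : ι → Space n) (i j : ι) :
    Submodule.span ℝ (polyFace u i ∩ polyFace u j) ≤ (ℝ ∙ (u i - u j))ᗮ := by
  rw [Submodule.span_le]
  rintro x ⟨hi, hj⟩
  rw [SetLike.mem_coe, mem_orthogonal_sub_iff, hi.2, hj.2]

lemma finrank_orthogonal_sub (h : IsFacetSystem u P) {i j : ι} (hij : i ≠ j) :
    Module.finrank ℝ (ℝ ∙ (u i - u j))ᗮ + 1 = n :=
  finrank_orthogonal_singleton (sub_ne_zero.2 (h.ne hij))

lemma span_ridge_eq (h : IsFacetSystem u P) {i j : ι} (hij : i ≠ j) {G : Set (Space n)}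
    (hG : IsRidge P G) (hi : G ⊆ polyFace u i) (hj : G ⊆ polyFace u j) :
    Submodule.span ℝ G = (ℝ ∙ (u i - u j))ᗮ := by
  refine Submodule.eq_of_le_of_finrank_eq
    ((Submodule.span_mono (Set.subset_inter hi hj)).trans (span_inter_le u i j)) ?_
  have h1 := finrank_span_eq_dim_add_one (fun x hx => (hi hx).2)
  have h2 := h.finrank_orthogonal_sub hij
  rw [hG.2] at h1
  omega

/-- At most two facets contain a given ridge: of three vectors on a line, one is a proper convex
combination of the other two, so that its inequality would be redundant. -/
lemma not_three_facets (h : IsFacetSystem u P) {i j k : ι} (hij : i ≠ j) (hik : i ≠ k)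
    (hjk : j ≠ k) {G : Set (Space n)} (hG : IsRidge P G) (hi : G ⊆ polyFace u i)
    (hj : G ⊆ polyFace u j) (hk : G ⊆ polyFace u k) : False := by
  have h1 := h.span_ridge_eq hij hG hi hj
  have h2 := h.span_ridge_eq hik hG hi hk
  have h3 : ℝ ∙ (u i - u j) = ℝ ∙ (u i - u k) := by
    rw [← Submodule.orthogonal_orthogonal (ℝ ∙ (u i - u j)), ← h1, h2,
      Submodule.orthogonal_orthogonal]
  have h4 : u i - u k ∈ ℝ ∙ (u i - u j) := h3 ▸ Submodule.mem_span_singleton_self _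
  obtain ⟨c, hc⟩ := Submodule.mem_span_singleton.1 h4
  have hx : ∀ x, c * (⟪u i, x⟫_ℝ - ⟪u j, x⟫_ℝ) = ⟪u i, x⟫_ℝ - ⟪u k, x⟫_ℝ := by
    intro x
    have := congrArg (fun v => ⟪v, x⟫_ℝ) hc
    simpa [real_inner_smul_left, inner_sub_left] using this
  obtain ⟨yi, hyi, hyi'⟩ := h.exists_mem_polyFace i
  obtain ⟨yj, hyj, hyj'⟩ := h.exists_mem_polyFace j
  obtain ⟨yk, hyk, hyk'⟩ := h.exists_mem_polyFace k
  have ei := hx yi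
  have ej := hx yj
  have ek := hx yk
  rw [hyi.2] at ei
  rw [hyj.2] at ej
  rw [hyk.2] at ek
  have a1 := hyi' j hij.symm
  have a2 := hyi' k hik.symm
  have b1 := hyj' i hij
  have b2 := hyj' k hjk.symm
  have c1 := hyk' i hik
  have c2 := hyk' j hjk
  rcases le_or_gt c 0 with hc0 | hc0
  · nlinarith
  rcases le_or_gt c 1 with hc1 | hc1
  · nlinarith
  · nlinarith

lemma isRidge_inter (h : IsFacetSystem u P) {i j : ι} (hij : i ≠ j)
    (hs : Submodule.span ℝ (polyFace u i ∩ polyFace u j) = (ℝ ∙ (u i - u j))ᗮ) :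
    IsRidge P (polyFace u i ∩ polyFace u j) := by
  refine ⟨h.eq ▸ (isExposed_polyFace u i).inter (isExposed_polyFace u j), ?_⟩
  have h1 := finrank_span_eq_dim_add_one (S := polyFace u i ∩ polyFace u j) (v := u i)
    (fun x hx => hx.1.2)
  rw [hs] at h1
  have h2 := h.finrank_orthogonal_sub hij
  omega

end IsFacetSystem

/-- Two facets are adjacent if they meet in a ridge, that is, if the linear span of their
intersection is a hyperplane. -/
def Adjacent (u : ι → Space n) (i j : ι) : Prop :=
  i ≠ j ∧ Submodule.span ℝ (polyFace u i ∩ polyFace u j) = (ℝ ∙ (u i - u j))ᗮ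

lemma eq_zero_of_ray_subset {K : Set (Space n)} (hK : Bornology.IsBounded K) {p z : Space n}
    (h : ∀ t : ℝ, 0 ≤ t → p + t • z ∈ K) : z = 0 := by
  obtain ⟨R, hR⟩ := isBounded_iff_forall_norm_le.1 hK
  by_contra hz
  have hz' : 0 < ‖z‖ := norm_pos_iff.2 hz
  have hR0 : 0 ≤ R := (norm_nonneg _).trans (hR _ (h 0 le_rfl))
  have h1 := hR _ (h ((R + ‖p‖ + 1) / ‖z‖) (by positivity))
  have h2 := norm_sub_le (p + ((R + ‖p‖ + 1) / ‖z‖) • z) p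
  rw [add_sub_cancel_left, norm_smul, Real.norm_of_nonneg (by positivity),
    div_mul_cancel₀ _ hz'.ne'] at h2
  linarith

/-- The step of the simplex method on the polar polytope: if `c` lies on the facet `k` only, then
every other facet has a neighbour whose functional is larger at `c`. -/
lemma IsFacetSystem.exists_adjacent_gt [Fintype ι] {u : ι → Space n} {P : Set (Space n)}
    (h : IsFacetSystem u P) {i k : ι} (hik : i ≠ k) {c : Space n} (hk : ⟪u k, c⟫_ℝ = 1)
    (hc : ⟪u i, c⟫_ℝ < 1) : ∃ j, Adjacent u i j ∧ ⟪u i, c⟫_ℝ < ⟪u j, c⟫_ℝ := by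
  classical
  obtain ⟨p, hp, hp'⟩ := h.exists_mem_polyFace i
  have hE : Convex ℝ {x : Space n | ⟪u i, x⟫_ℝ = 1} :=
    convex_hyperplane (innerSL ℝ (u i)).isLinear 1
  obtain ⟨J, hJ, hJ1, hJ2⟩ := exists_irredundant hE hp.2 (Finset.univ.erase i) u
    (fun j hj => hp' j (Finset.ne_of_mem_erase hj))
  have hmem : ∀ x, ⟪u i, x⟫_ℝ = 1 → (∀ j ∈ J, ⟪u j, x⟫_ℝ ≤ 1) → x ∈ polyhedron u := by
    intro x hx hxJ j
    by_cases hj : j = i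
    · rw [hj, hx]
    · exact hJ1 x hx hxJ j (Finset.mem_erase.2 ⟨hj, Finset.mem_univ _⟩)
  have hadj : ∀ j ∈ J, Adjacent u i j := by
    intro j hj
    have hji : j ≠ i := Finset.ne_of_mem_erase (hJ hj)
    refine ⟨hji.symm, le_antisymm (IsFacetSystem.span_inter_le u i j) ?_⟩
    obtain ⟨y, hy, hyj, hyJ⟩ := hJ2 j hj
    have hy : ⟪u i, y⟫_ℝ = 1 := hy
    have hyP : y ∈ polyhedron u := hmem y hy (fun l hl => by
      by_cases hlj : l = j
      · rw [hlj, hyj]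
      · exact (hyJ l hl hlj).le)
    refine le_span_of_forall_eventually ⟨⟨hyP, hy⟩, ⟨hyP, hyj⟩⟩
      (mem_orthogonal_sub_iff.2 (hy.trans hyj.symm)) hy fun x hx hx0 => ?_
    have hxj : ⟪u j, x⟫_ℝ = 0 := (mem_orthogonal_sub_iff.1 hx).symm.trans hx0
    have hev : ∀ᶠ ε : ℝ in nhds 0, ∀ l, l ∈ J → l ≠ j → ⟪u l, y + ε • x⟫_ℝ < 1 := by
      rw [Filter.eventually_all]
      intro l
      by_cases hl : l ∈ J ∧ l ≠ j
      · filter_upwards [eventually_inner_add_smul_lt (v := x) (hyJ l hl.1 hl.2)] with ε hε _ _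
          using hε
      · exact Filter.Eventually.of_forall fun ε h1 h2 => absurd ⟨h1, h2⟩ hl
    filter_upwards [hev] with ε hε
    have e1 : ⟪u i, y + ε • x⟫_ℝ = 1 := by
      rw [inner_add_right, inner_smul_right, hx0, hy]; ring
    have e2 : ⟪u j, y + ε • x⟫_ℝ = 1 := by
      rw [inner_add_right, inner_smul_right, hxj, hyj]; ring
    have e3 : y + ε • x ∈ polyhedron u := hmem _ e1 (fun l hl => by
      by_cases hlj : l = j
      · rw [hlj, e2]
      · exact (hε l hl hlj).le)
    exact ⟨⟨e3, e1⟩, ⟨e3, e2⟩⟩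
  by_cases hex : ∃ j ∈ J, ⟪u i, c⟫_ℝ < ⟪u j, c⟫_ℝ
  · obtain ⟨j, hj, hjc⟩ := hex
    exact ⟨j, hadj j hj, hjc⟩
  push Not at hex
  set a := ⟪u i, c⟫_ℝ with ha
  rcases lt_or_ge 0 a with ha0 | ha0
  · exfalso
    have hin : ∀ j, ⟪u j, a⁻¹ • c⟫_ℝ = a⁻¹ * ⟪u j, c⟫_ℝ := fun j => inner_smul_right _ _ _
    have := hmem (a⁻¹ • c) (by rw [hin, ← ha, inv_mul_cancel₀ ha0.ne'])
      (fun j hj => by rw [hin, inv_mul_le_iff₀ ha0, mul_one]; exact hex j hj) k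
    rw [hin, hk, mul_one, inv_le_one₀ ha0] at this
    linarith
  · have hray : c - a • p = 0 := by
      refine eq_zero_of_ray_subset h.bdd (p := p) fun t ht => hmem _ ?_ fun j hj => ?_
      · rw [inner_add_right, inner_smul_right, inner_sub_right, inner_smul_right, hp.2, ← ha]; ring
      · rw [inner_add_right, inner_smul_right, inner_sub_right, inner_smul_right]
        have h1 := hp' j (Finset.ne_of_mem_erase (hJ hj))
        have h2 := hex j hj
        have h3 : ⟪u j, c⟫_ℝ - a * ⟪u j, p⟫_ℝ ≤ 0 := by nlinarith
        nlinarith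
    have hcp : c = a • p := sub_eq_zero.1 hray
    have ha1 : a < 0 := by
      refine lt_of_le_of_ne ha0 fun h0 => ?_
      rw [hcp, h0, zero_smul, inner_zero_right] at hk
      exact zero_ne_one hk
    -- only `n = 1` remains, where all facets are points and any two of them are adjacent
    have hJe : ∀ j, j ∉ J := by
      intro j hj
      have h1 := hp' j (Finset.ne_of_mem_erase (hJ hj))
      have h2 := hex j hj
      rw [hcp, inner_smul_right] at h2
      nlinarith
    have hbot : (ℝ ∙ u i)ᗮ = ⊥ := by
      rw [eq_bot_iff]
      intro z hz
      rw [Submodule.mem_orthogonal_singleton_iff_inner_right] at hz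
      refine (Submodule.mem_bot ℝ).2 (eq_zero_of_ray_subset h.bdd (p := p) fun t _ =>
        hmem _ ?_ fun j hj => absurd hj (hJe j))
      rw [inner_add_right, inner_smul_right, hz, hp.2]; ring
    have hn1 := finrank_orthogonal_singleton (h.ne_zero i)
    rw [hbot, finrank_bot] at hn1
    have hn2 := h.finrank_orthogonal_sub hik
    have hbot' : (ℝ ∙ (u i - u k))ᗮ = ⊥ := Submodule.finrank_eq_zero.1 (by omega)
    refine ⟨k, ⟨hik, le_antisymm (IsFacetSystem.span_inter_le u i k) ?_⟩, by rw [hk]; exact hc⟩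
    rw [hbot']
    exact bot_le

/-- The facets of a polytope are connected through its ridges. -/
lemma IsFacetSystem.forall_of_adjacent [Fintype ι] {u : ι → Space n} {P : Set (Space n)}
    (h : IsFacetSystem u P) (p : ι → Prop) (hp : ∃ i, p i)
    (hstep : ∀ i j, p i → Adjacent u i j → p j) (k : ι) : p k := by
  by_contra hk
  obtain ⟨c, hc, hc'⟩ := h.exists_mem_polyFace k
  obtain ⟨i0, hi0⟩ := hp
  have : Nonempty {i // p i} := ⟨⟨i0, hi0⟩⟩
  obtain ⟨⟨i, hi⟩, hmax⟩ := Finite.exists_max (fun i : {i // p i} => ⟪u i, c⟫_ℝ)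
  have hik : i ≠ k := by rintro rfl; exact hk hi
  obtain ⟨j, hj, hlt⟩ := h.exists_adjacent_gt hik hc.2 (hc' i hik)
  exact absurd (hmax ⟨j, hstep i j hi hj⟩) (not_le.2 hlt)

/-- A linear isometry that maps a facet to a facet maps the ridges in the one to the ridges in the
other. -/
lemma IsFacetSystem.image_inter_of_adjacent [Fintype ι] {u : ι → Space n} {P : Set (Space n)}
    (h : IsFacetSystem u P) (g : Space n ≃ₗᵢ[ℝ] Space n) {i j k : ι}
    (hg : g '' polyFace u i = polyFace u k) (hij : Adjacent u i j) :
    ∃ l, Adjacent u k l ∧ g '' (polyFace u i ∩ polyFace u j) = polyFace u k ∩ polyFace u l := by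
  classical
  set G := polyFace u i ∩ polyFace u j with hG
  have hGk : g '' G ⊆ polyFace u k := by
    rw [← hg]; exact Set.image_mono Set.inter_subset_left
  have hl : ∃ l, l ≠ k ∧ g '' G ⊆ polyFace u l := by
    by_contra! hcon
    have hne : (g '' G).Nonempty := by
      by_contra hemp
      rw [Set.not_nonempty_iff_eq_empty] at hemp
      have hall : ∀ l, l = k := by
        intro l
        by_contra hl
        exact hcon l hl (by rw [hemp]; exact Set.empty_subset _)
      exact hij.1 ((hall i).trans (hall j).symm)
    have hconv : Convex ℝ (g '' G) := by
      refine Convex.linear_image ?_ g.toLinearEquiv.toLinearMap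
      exact ((isExposed_polyFace u i).inter (isExposed_polyFace u j)).convex (convex_polyhedron u)
    obtain ⟨y, hyG, hy⟩ := exists_forall_inner_lt_one hconv hne u (Finset.univ.erase k)
      (fun x hx l _ => (hGk hx).1 l) (fun l hl => by
        obtain ⟨x, hx, hxl⟩ := Set.not_subset.1 (hcon l (Finset.ne_of_mem_erase hl))
        exact ⟨x, hx, lt_of_le_of_ne ((hGk hx).1 l) fun he => hxl ⟨(hGk hx).1, he⟩⟩)
    have hyk := (hGk hyG).2
    obtain ⟨y', hy', rfl⟩ := hyG
    obtain ⟨x0, hx0, hx0'⟩ := h.exists_mem_polyFace i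
    have hx0k : g x0 ∈ polyFace u k := hg ▸ Set.mem_image_of_mem g hx0
    -- prolong the segment from `g x0` to `g y'` inside the facet `k`
    have hev : ∀ᶠ ε : ℝ in nhds 0, ∀ l, l ≠ k → ⟪u l, g y' + ε • (g y' - g x0)⟫_ℝ < 1 := by
      rw [Filter.eventually_all]
      intro l
      by_cases hl : l = k
      · simp [hl]
      · filter_upwards [eventually_inner_add_smul_lt (v := g y' - g x0)
          (hy l (Finset.mem_erase.2 ⟨hl, Finset.mem_univ _⟩))] with ε hε _ using hε
    obtain ⟨ε, hε, hε0⟩ := ((hev.filter_mono nhdsWithin_le_nhds).and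
      (self_mem_nhdsWithin : Set.Ioi (0 : ℝ) ∈ nhdsWithin 0 (Set.Ioi 0))).exists
    have hε0 : 0 < ε := hε0
    have hmem : g (y' + ε • (y' - x0)) ∈ polyFace u k := by
      rw [map_add, map_smul, map_sub]
      have e1 : ⟪u k, g y' + ε • (g y' - g x0)⟫_ℝ = 1 := by
        rw [inner_add_right, inner_smul_right, inner_sub_right, hyk, hx0k.2]; ring
      refine ⟨fun l => ?_, e1⟩
      by_cases hl : l = k
      · rw [hl, e1]
      · exact (hε l hl).le
    rw [← hg] at hmem
    have hmem' := (g.injective.mem_set_image.1 hmem).1 j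
    rw [inner_add_right, inner_smul_right, inner_sub_right, hy'.2.2] at hmem'
    have := hx0' j hij.1.symm
    nlinarith
  obtain ⟨l, hlk, hGl⟩ := hl
  have hle1 : Submodule.span ℝ (g '' G) ≤ Submodule.span ℝ (polyFace u k ∩ polyFace u l) :=
    Submodule.span_mono (Set.subset_inter hGk hGl)
  have hle2 := IsFacetSystem.span_inter_le u k l
  have hmap : Submodule.span ℝ (g '' G) = (Submodule.span ℝ G).map g.toLinearEquiv.toLinearMap :=
    (Submodule.map_span g.toLinearEquiv.toLinearMap G).symm
  have hfr : Module.finrank ℝ (Submodule.span ℝ (g '' G)) =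
      Module.finrank ℝ (ℝ ∙ (u k - u l))ᗮ := by
    have h1 := h.finrank_orthogonal_sub hlk.symm
    have h2 := h.finrank_orthogonal_sub hij.1
    have h3 : Module.finrank ℝ (Submodule.span ℝ (g '' G)) =
        Module.finrank ℝ (Submodule.span ℝ G) := by
      rw [hmap]; exact LinearEquiv.finrank_map_eq g.toLinearEquiv _
    rw [hij.2] at h3
    omega
  have heq := Submodule.eq_of_le_of_finrank_eq (hle1.trans hle2) hfr
  refine ⟨l, ⟨hlk.symm, le_antisymm hle2 (heq ▸ hle1)⟩,
    Set.Subset.antisymm (Set.subset_inter hGk hGl) ?_⟩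
  rintro x ⟨hxk, hxl⟩
  have hx : x ∈ Submodule.span ℝ (g '' G) := by
    rw [heq]; exact hle2 (Submodule.subset_span ⟨hxk, hxl⟩)
  rw [hmap] at hx
  obtain ⟨x', hx', rfl⟩ := hx
  have hx'i : x' ∈ polyFace u i := by
    have : g x' ∈ g '' polyFace u i := hg ▸ hxk
    exact g.injective.mem_set_image.1 this
  rw [hij.2] at hx'
  exact ⟨x', ⟨hx'i, hx'i.1, (mem_orthogonal_sub_iff.1 hx').symm.trans hx'i.2⟩, rfl⟩

/-! ### Affine reflectors that are orthogonal reflections -/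

lemma isClosed_pyramid (u : ι → Space n) (i : ι) : IsClosed (pyramid u i) := by
  have : pyramid u i = polyhedron u ∩ ⋂ j, {x : Space n | ⟪u j, x⟫_ℝ ≤ ⟪u i, x⟫_ℝ} := by
    ext x; simp [pyramid]
  rw [this]
  exact (isClosed_polyhedron u).inter
    (isClosed_iInter fun j => isClosed_le (by fun_prop) (by fun_prop))

lemma IsFacetSystem.isCompact_pyramid (h : IsFacetSystem u P) (i : ι) :
    IsCompact (pyramid u i) :=
  Metric.isCompact_of_isClosed_isBounded (isClosed_pyramid u i)
    (h.bdd.subset fun _ hx => hx.1)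

lemma IsFacetSystem.mem_pyramid_iff (h : IsFacetSystem u P) {i : ι} {x : Space n} :
    x ∈ pyramid u i ↔ ∃ s : ℝ, 0 ≤ s ∧ s ≤ 1 ∧ ∃ y ∈ polyFace u i, s • y = x := by
  constructor
  · rintro ⟨hx, hxi⟩
    rcases lt_or_ge 0 ⟪u i, x⟫_ℝ with ha | ha
    · refine ⟨⟪u i, x⟫_ℝ, ha.le, hx i, (⟪u i, x⟫_ℝ)⁻¹ • x, ⟨fun j => ?_, ?_⟩, ?_⟩
      · rw [inner_smul_right, inv_mul_le_iff₀ ha, mul_one]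
        exact hxi j
      · rw [inner_smul_right, inv_mul_cancel₀ ha.ne']
      · rw [smul_smul, mul_inv_cancel₀ ha.ne', one_smul]
    · obtain ⟨y, hy, -⟩ := h.exists_mem_polyFace i
      have hx0 : x = 0 := eq_zero_of_ray_subset h.bdd (p := 0) fun t ht j => by
        rw [zero_add, inner_smul_right]
        nlinarith [hxi j]
      exact ⟨0, le_rfl, zero_le_one, y, hy, by rw [hx0, zero_smul]⟩
  · rintro ⟨s, hs0, hs1, y, hy, rfl⟩
    refine ⟨fun j => ?_, fun j => ?_⟩
    · rw [inner_smul_right]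
      nlinarith [hy.1 j]
    · rw [inner_smul_right, inner_smul_right, hy.2]
      nlinarith [hy.1 j]

lemma exists_mem_pyramid [Finite ι] [Nonempty ι] {x : Space n} (hx : x ∈ polyhedron u) :
    ∃ i, x ∈ pyramid u i := by
  obtain ⟨i, hi⟩ := Finite.exists_max fun j => ⟪u j, x⟫_ℝ
  exact ⟨i, hx, hi⟩

/-- A function of the form `⟪w, x⟫ * ⟪m, x⟫ ^ 2` with `w` positive inside a pyramid can have
integral zero there only if `m = 0`. -/
lemma IsFacetSystem.eq_zero_of_integral_pyramid [Finite ι] (h : IsFacetSystem u P) {i j : ι}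
    (hij : i ≠ j) {m : Space n}
    (hm : ∫ x in pyramid u i, ⟪u i - u j, x⟫_ℝ * ⟪m, x⟫_ℝ ^ 2 = 0) : m = 0 := by
  set φ : Space n → ℝ := fun x => ⟪u i - u j, x⟫_ℝ * ⟪m, x⟫_ℝ ^ 2 with hφ
  have hφc : Continuous φ := by fun_prop
  have hmeas := (isClosed_pyramid u i).measurableSet
  have hae : φ =ᵐ[MeasureTheory.volume.restrict (pyramid u i)] 0 := by
    refine (MeasureTheory.setIntegral_eq_zero_iff_of_nonneg_ae ?_ ?_).1 hm
    · filter_upwards [MeasureTheory.ae_restrict_mem hmeas] with x hx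
      have := hx.2 j
      change 0 ≤ ⟪u i - u j, x⟫_ℝ * ⟪m, x⟫_ℝ ^ 2
      rw [inner_sub_left]
      exact mul_nonneg (by linarith) (sq_nonneg _)
    · exact hφc.continuousOn.integrableOn_compact (h.isCompact_pyramid i)
  set U : Set (Space n) :=
    {x | ∀ k, ⟪u k, x⟫_ℝ < 1 ∧ (k ≠ i → ⟪u k, x⟫_ℝ < ⟪u i, x⟫_ℝ)} with hU
  have hUo : IsOpen U := by
    have : U = ⋂ k, ({x : Space n | ⟪u k, x⟫_ℝ < 1} ∩
        {x : Space n | k ≠ i → ⟪u k, x⟫_ℝ < ⟪u i, x⟫_ℝ}) := by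
      ext x; simp [U]
    rw [this]
    refine isOpen_iInter_of_finite fun k => (isOpen_lt (by fun_prop) (by fun_prop)).inter ?_
    by_cases hk : k = i
    · simp [hk]
    · simp only [ne_eq, hk, not_false_eq_true, true_imp_iff]
      exact isOpen_lt (by fun_prop) (by fun_prop)
  have hUp : U ⊆ pyramid u i := by
    intro x hx
    refine ⟨fun k => (hx k).1.le, fun k => ?_⟩
    by_cases hk : k = i
    · rw [hk]
    · exact ((hx k).2 hk).le
  have heq : Set.EqOn φ 0 U :=
    MeasureTheory.Measure.eqOn_open_of_ae_eq
      (MeasureTheory.ae_restrict_of_ae_restrict_of_subset hUp hae) hUo hφc.continuousOn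
      continuous_const.continuousOn
  have hmU : ∀ x ∈ U, ⟪m, x⟫_ℝ = 0 := by
    intro x hx
    have h1 := heq hx
    have h2 := (hx j).2 hij.symm
    have h3 : ⟪u i - u j, x⟫_ℝ ≠ 0 := by rw [inner_sub_left]; linarith
    simpa [φ, h3] using h1
  obtain ⟨y, hy, hy'⟩ := h.exists_strict i
  set z : Space n := (1 / 2 : ℝ) • y
  have hz : z ∈ U := by
    intro k
    simp only [z, inner_smul_right, hy]
    by_cases hk : k = i
    · subst hk; simp [hy]; norm_num
    · have := hy' k hk
      exact ⟨by linarith, fun _ => by linarith⟩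
  have hcont : Filter.Tendsto (fun ε : ℝ => z + ε • m) (nhds 0) (nhds z) :=
    (by fun_prop : Continuous fun ε : ℝ => z + ε • m).tendsto' 0 z (by simp)
  obtain ⟨ε, hε, hε0⟩ := (((hcont.eventually (hUo.mem_nhds hz)).filter_mono
    nhdsWithin_le_nhds).and
    (self_mem_nhdsWithin : Set.Ioi (0 : ℝ) ∈ nhdsWithin 0 (Set.Ioi 0))).exists
  have hε0 : ε ≠ 0 := ne_of_gt hε0
  have := hmU _ hε
  rw [inner_add_right, hmU z hz, inner_smul_right, zero_add] at this
  exact inner_self_eq_zero.1 ((mul_eq_zero.1 this).resolve_left hε0)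

lemma reflection_apply_of_eq_orthogonal_singleton {K : Submodule ℝ (Space n)} {w : Space n}
    (hK : K = (ℝ ∙ w)ᗮ) (x : Space n) :
    K.reflection x = x - (2 * (⟪w, x⟫_ℝ / ‖w‖ ^ 2)) • w := by
  subst hK
  rw [Submodule.reflection_orthogonal_apply, Submodule.reflection_singleton_apply, neg_sub,
    ← smul_assoc, two_smul, two_mul]
  rfl

/-- Suppose that on the pyramids over all facets the first-order condition of a local extremum
holds. Then an affine map that fixes a ridge and maps one of its facets to the other one acts on
that facet as the orthogonal reflection across the span of the ridge. Indeed its linear extension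
`T` maps pyramid to pyramid and has the form `T x = x + ⟪w, x⟫ • a`, hence
`‖T x‖ ^ 2 - ‖x‖ ^ 2 = ⟪w, x⟫ * ⟪m, x⟫` for some `m`; the two first-order conditions make this
orthogonal to all linear functionals on the pyramid, in particular to `⟪m, x⟫`. -/
lemma IsFacetSystem.reflection_image [Finite ι] (h : IsFacetSystem u P) {c : ℝ}
    (hstar : ∀ i v, ∫ x in pyramid u i, ‖x‖ ^ 2 * ⟪v, x⟫_ℝ = c * ∫ x in pyramid u i, ⟪v, x⟫_ℝ)
    {i j : ι} (hij : i ≠ j) {G : Set (Space n)} (hG : IsRidge P G) (hi : G ⊆ polyFace u i)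
    (hj : G ⊆ polyFace u j) (f : Space n →ᵃ[ℝ] Space n) (hf : f '' polyFace u i = polyFace u j)
    (hfG : ∀ x ∈ G, f x = x) :
    (Submodule.span ℝ G).reflection '' polyFace u i = polyFace u j := by
  have hspan := h.span_ridge_eq hij hG hi hj
  -- the linear extension of the restriction of `f` to the hyperplane of the facet `i`
  set T : Space n →ₗ[ℝ] Space n :=
    f.linear + ((innerSL ℝ (u i) : Space n →L[ℝ] ℝ) : Space n →ₗ[ℝ] ℝ).smulRight (f 0) with hT
  have hTf : ∀ x, ⟪u i, x⟫_ℝ = 1 → T x = f x := by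
    intro x hx
    have h1 := congrFun (AffineMap.decomp f) x
    simp only [Pi.add_apply] at h1
    simp [hT, hx, h1]
  have hTF : T '' polyFace u i = polyFace u j := by
    rw [← hf]
    exact Set.image_congr fun x hx => hTf x hx.2
  have hsurj : Function.Surjective T := by
    have h1 := h.span_polyFace j
    rw [← hTF, ← Submodule.map_span, h.span_polyFace, Submodule.map_top] at h1
    exact LinearMap.range_eq_top.1 h1
  have hinj : Function.Injective T := LinearMap.injective_iff_surjective.2 hsurj
  have hTC : T '' pyramid u i = pyramid u j := by
    ext x
    rw [h.mem_pyramid_iff]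
    constructor
    · rintro ⟨x, hx, rfl⟩
      obtain ⟨s, hs0, hs1, y, hy, rfl⟩ := h.mem_pyramid_iff.1 hx
      exact ⟨s, hs0, hs1, T y, hTF ▸ Set.mem_image_of_mem T hy, (map_smul T s y).symm⟩
    · rintro ⟨s, hs0, hs1, y, hy, rfl⟩
      rw [← hTF] at hy
      obtain ⟨y, hy, rfl⟩ := hy
      exact ⟨s • y, h.mem_pyramid_iff.2 ⟨s, hs0, hs1, y, hy, rfl⟩, map_smul T s y⟩
  have hTG : ∀ x ∈ (ℝ ∙ (u i - u j))ᗮ, T x = x := by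
    intro x hx
    rw [← hspan] at hx
    have : Set.EqOn T (LinearMap.id : Space n →ₗ[ℝ] Space n) G := fun x hx => by
      rw [hTf x (hi hx).2, hfG x hx]; rfl
    exact LinearMap.eqOn_span this hx
  -- `T` fixes the hyperplane orthogonal to `w` pointwise, hence `T x - x` is a multiple of `⟪w, x⟫`
  set w := u i - u j with hw
  obtain ⟨y0, hy0, hy0'⟩ := h.exists_strict i
  have hwy : ⟪w, y0⟫_ℝ ≠ 0 := by
    have := hy0' j hij.symm
    rw [hw, inner_sub_left]; linarith
  set a : Space n := (⟪w, y0⟫_ℝ)⁻¹ • (T y0 - y0) with ha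
  have hTx : ∀ x, T x = x + ⟪w, x⟫_ℝ • a := by
    intro x
    have hx := hTG (x - (⟪w, x⟫_ℝ * (⟪w, y0⟫_ℝ)⁻¹) • y0) (by
      rw [Submodule.mem_orthogonal_singleton_iff_inner_right, inner_sub_right, inner_smul_right,
        mul_assoc, inv_mul_cancel₀ hwy, mul_one, sub_self])
    rw [map_sub, map_smul, sub_eq_iff_eq_add] at hx
    rw [hx, ha, smul_smul, smul_sub]
    abel
  clear_value a
  set m : Space n := (2 : ℝ) • a + ‖a‖ ^ 2 • w with hm
  have hq : ∀ x, ‖T x‖ ^ 2 - ‖x‖ ^ 2 = ⟪w, x⟫_ℝ * ⟪m, x⟫_ℝ := by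
    intro x
    rw [hTx, norm_add_sq_real, norm_smul, inner_smul_right, hm, inner_add_left,
      real_inner_smul_left, real_inner_smul_left, mul_pow, real_inner_comm a x, Real.norm_eq_abs,
      sq_abs]
    ring
  have hcov : ∀ g : Space n → ℝ, ∫ x in pyramid u j, g x =
      |LinearMap.det T| * ∫ x in pyramid u i, g (T x) := by
    intro g
    rw [← hTC, MeasureTheory.integral_image_eq_integral_abs_det_fderiv_smul MeasureTheory.volume
      (isClosed_pyramid u i).measurableSet (f := T) (f' := fun _ => T.toContinuousLinearMap)
      (fun x _ => T.toContinuousLinearMap.hasFDerivWithinAt) hinj.injOn]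
    rw [← smul_eq_mul, ← MeasureTheory.integral_smul]
    rfl
  have hdet : |LinearMap.det T| ≠ 0 := by
    rw [abs_ne_zero]
    intro h0
    have := LinearMap.bot_lt_ker_of_det_eq_zero h0
    rw [LinearMap.ker_eq_bot.2 hinj] at this
    exact lt_irrefl _ this
  have hint : ∀ g : Space n → ℝ, Continuous g →
      MeasureTheory.IntegrableOn g (pyramid u i) MeasureTheory.volume :=
    fun g hg => hg.continuousOn.integrableOn_compact (h.isCompact_pyramid i)
  have hTcont : Continuous T := T.continuous_of_finiteDimensional
  have horth : ∀ v, ∫ x in pyramid u i, (‖T x‖ ^ 2 - ‖x‖ ^ 2) * ⟪v, x⟫_ℝ = 0 := by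
    intro v
    set e := LinearEquiv.ofBijective T ⟨hinj, hsurj⟩
    set v' := LinearMap.adjoint (e.symm : Space n →ₗ[ℝ] Space n) v
    have hv' : ∀ x, ⟪v', T x⟫_ℝ = ⟪v, x⟫_ℝ := by
      intro x
      rw [LinearMap.adjoint_inner_left]
      congr 1
      exact e.symm_apply_apply x
    have h1 := hstar j v'
    rw [hcov, hcov] at h1
    simp only [hv'] at h1
    have h2 := hstar i v
    have h3 : ∫ x in pyramid u i, ‖T x‖ ^ 2 * ⟪v, x⟫_ℝ = c * ∫ x in pyramid u i, ⟪v, x⟫_ℝ := by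
      apply mul_left_cancel₀ hdet
      linarith
    simp only [sub_mul]
    rw [MeasureTheory.integral_sub (hint _ (by fun_prop)) (hint _ (by fun_prop)), h2, h3, sub_self]
  have hm0 : m = 0 := by
    apply h.eq_zero_of_integral_pyramid hij
    rw [← horth m]
    congr 1
    ext x
    rw [hq]; ring
  have hane : a ≠ 0 := by
    intro ha0
    refine hij (h.polyFace_injective ?_)
    rw [← hTF]
    ext x
    simp [hTx, ha0]
  have hanorm : ‖a‖ ^ 2 ≠ 0 := pow_ne_zero 2 (norm_ne_zero_iff.2 hane)
  have haw : a = -(‖a‖ ^ 2 / 2) • w := by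
    have : (2 : ℝ) • a = -(‖a‖ ^ 2) • w := by
      rw [neg_smul]; exact eq_neg_of_add_eq_zero_left hm0
    calc a = (1 / 2 : ℝ) • (2 : ℝ) • a := by rw [smul_smul]; norm_num
      _ = _ := by rw [this, smul_smul]; congr 1; ring
  have hprod : ‖a‖ ^ 2 * ‖w‖ ^ 2 = 4 := by
    have h1 : ‖a‖ ^ 2 = (‖a‖ ^ 2 / 2) ^ 2 * ‖w‖ ^ 2 := by
      conv_lhs => rw [haw, norm_smul, mul_pow, Real.norm_eq_abs, sq_abs, neg_sq]
    have h2 : ‖a‖ ^ 2 * (‖a‖ ^ 2 * ‖w‖ ^ 2) = ‖a‖ ^ 2 * 4 := by linarith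
    exact mul_left_cancel₀ hanorm h2
  have hwn : ‖w‖ ^ 2 ≠ 0 := by
    intro h0
    rw [h0, mul_zero] at hprod
    norm_num at hprod
  have hrefl : ∀ x, (Submodule.span ℝ G).reflection x = T x := by
    intro x
    rw [reflection_apply_of_eq_orthogonal_singleton hspan, hTx]
    have h2 : ‖a‖ ^ 2 / 2 = 2 / ‖w‖ ^ 2 := by
      rw [div_eq_div_iff two_ne_zero hwn, hprod]; norm_num
    conv_rhs => rw [haw, h2]
    rw [smul_smul, sub_eq_add_neg, ← neg_smul]
    congr 2
    ring
  rw [← hTF]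
  exact Set.image_congr fun x _ => hrefl x

/-! ### Symmetries of the polytope -/

lemma image_of_reflection_image {K : Submodule ℝ (Space n)} {A B : Set (Space n)}
    (h : K.reflection '' A = B) : K.reflection '' B = A := by
  rw [← h, Set.image_image]
  simp

/-- The symmetry of a ridge: the orthogonal reflection across the span of the ridge exchanges the
two facets that meet in it. -/
def ReflectsFacets (u : ι → Space n) (i j : ι) : Prop :=
  (Submodule.span ℝ (polyFace u i ∩ polyFace u j)).reflection '' polyFace u i = polyFace u j

/-- If all ridges exchange their facets by reflection, a linear isometry that maps one facet to a
facet maps all facets to facets. -/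
lemma IsFacetSystem.exists_image_eq [Fintype ι] (h : IsFacetSystem u P)
    (hadj : ∀ i j, Adjacent u i j → ReflectsFacets u i j) (g : Space n ≃ₗᵢ[ℝ] Space n)
    (hg : ∃ i k, g '' polyFace u i = polyFace u k) (i : ι) :
    ∃ k, g '' polyFace u i = polyFace u k := by
  refine h.forall_of_adjacent (fun i => ∃ k, g '' polyFace u i = polyFace u k) hg ?_ i
  rintro i j ⟨k, hk⟩ hij
  obtain ⟨l, hl, hkl⟩ := h.image_inter_of_adjacent g hk hij
  refine ⟨l, ?_⟩
  have h1 : (Submodule.span ℝ (polyFace u i ∩ polyFace u j)).reflection '' polyFace u i =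
    polyFace u j := hadj i j hij
  have h2 : (Submodule.span ℝ (polyFace u k ∩ polyFace u l)).reflection '' polyFace u k =
    polyFace u l := hadj k l hl
  have h3 : ∀ K : Submodule ℝ (Space n),
      K = (Submodule.span ℝ (polyFace u i ∩ polyFace u j)).map g.toLinearEquiv.toLinearMap →
      ∀ x, K.reflection (g x) =
        g ((Submodule.span ℝ (polyFace u i ∩ polyFace u j)).reflection x) := by
    rintro K rfl x
    have := Submodule.reflection_map_apply g
      (Submodule.span ℝ (polyFace u i ∩ polyFace u j)) (g x)
    rw [g.symm_apply_apply] at this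
    exact this
  have h4 := h3 (Submodule.span ℝ (polyFace u k ∩ polyFace u l)) (by
    rw [← hkl, Submodule.map_span]; rfl)
  rw [← h1, ← h2, Set.image_image]
  conv_rhs => enter [2]; rw [← hk]
  rw [Set.image_image]
  exact Set.image_congr fun x _ => (h4 x).symm

lemma IsFacetSystem.image_subset [Fintype ι] [Nonempty ι] (h : IsFacetSystem u P)
    (g : Space n ≃ₗᵢ[ℝ] Space n) (hg : ∀ i, ∃ k, g '' polyFace u i = polyFace u k) :
    g '' P ⊆ P := by
  rw [← h.eq]
  rintro _ ⟨x, hx, rfl⟩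
  obtain ⟨i, hi⟩ := exists_mem_pyramid hx
  obtain ⟨s, hs0, hs1, y, hy, rfl⟩ := h.mem_pyramid_iff.1 hi
  obtain ⟨k, hk⟩ := hg i
  have : g y ∈ polyFace u k := hk ▸ Set.mem_image_of_mem g hy
  exact (h.mem_pyramid_iff.2 ⟨s, hs0, hs1, g y, this, (map_smul g s y).symm⟩ :
    g (s • y) ∈ pyramid u k).1

lemma IsFacetSystem.reflection_image_eq [Fintype ι] [Nonempty ι] (h : IsFacetSystem u P)
    (hadj : ∀ i j, Adjacent u i j → ReflectsFacets u i j) (K : Submodule ℝ (Space n))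
    {i k : ι} (hK : K.reflection '' polyFace u i = polyFace u k) : K.reflection '' P = P := by
  have hsub := h.image_subset K.reflection (h.exists_image_eq hadj K.reflection ⟨i, k, hK⟩)
  refine hsub.antisymm ?_
  have := Set.image_mono (f := K.reflection) hsub
  rw [Set.image_image] at this
  simpa using this

lemma IsFacetSystem.isIsohedral [Fintype ι] [Nonempty ι] (h : IsFacetSystem u P) (hn : n ≠ 0)
    (hadj : ∀ i j, Adjacent u i j → ReflectsFacets u i j) : IsIsohedral P := by
  intro F F' hF hF'
  obtain ⟨i, rfl⟩ := (h.isFacet_iff hn).1 hF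
  obtain ⟨k, rfl⟩ := (h.isFacet_iff hn).1 hF'
  have key : ∃ g : Space n ≃ₗᵢ[ℝ] Space n, g '' P = P ∧ g '' polyFace u i = polyFace u k := by
    refine h.forall_of_adjacent (fun k => ∃ g : Space n ≃ₗᵢ[ℝ] Space n, g '' P = P ∧
      g '' polyFace u i = polyFace u k) ⟨i, LinearIsometryEquiv.refl ℝ _, by simp, by simp⟩ ?_ k
    rintro j l ⟨g, hgP, hg⟩ hjl
    have h1 : (Submodule.span ℝ (polyFace u j ∩ polyFace u l)).reflection '' polyFace u j =
      polyFace u l := hadj j l hjl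
    refine ⟨g.trans (Submodule.span ℝ (polyFace u j ∩ polyFace u l)).reflection, ?_, ?_⟩
    · rw [LinearIsometryEquiv.coe_trans, Set.image_comp, hgP]
      exact h.reflection_image_eq hadj _ h1
    · rw [LinearIsometryEquiv.coe_trans, Set.image_comp, hg, h1]
  obtain ⟨g, hg1, hg2⟩ := key
  exact ⟨g.toAffineIsometryEquiv, hg1, hg2⟩

/-- The conclusion of the theorem from the first-order conditions on the pyramids. -/
lemma IsFacetSystem.symmetric_and_isohedral [Fintype ι] [Nonempty ι] (h : IsFacetSystem u P)
    (hn : n ≠ 0) {c : ℝ}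
    (hstar : ∀ i v, ∫ x in pyramid u i, ‖x‖ ^ 2 * ⟪v, x⟫_ℝ = c * ∫ x in pyramid u i, ⟪v, x⟫_ℝ)
    (hrefl : ∀ G, IsRidge P G → IsAffineReflector P G) :
    (∀ G, IsRidge P G → IsSymmetricHyperplane P (Submodule.span ℝ G)) ∧ IsIsohedral P := by
  have hridge : ∀ G, IsRidge P G → ∃ a b, a ≠ b ∧ G ⊆ polyFace u a ∧ G ⊆ polyFace u b ∧
      (Submodule.span ℝ G).reflection '' polyFace u a = polyFace u b := by
    intro G hG
    obtain ⟨-, F₁, F₂, hF₁, hF₂, hne, hG₁, hG₂, f, hf, hfG⟩ := hrefl G hG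
    obtain ⟨a, rfl⟩ := (h.isFacet_iff hn).1 hF₁
    obtain ⟨b, rfl⟩ := (h.isFacet_iff hn).1 hF₂
    have hab : a ≠ b := fun he => hne (congrArg _ he)
    exact ⟨a, b, hab, hG₁, hG₂, h.reflection_image hstar hab hG hG₁ hG₂ f hf hfG⟩
  have hadj : ∀ i j, Adjacent u i j → ReflectsFacets u i j := by
    intro i j hij
    have hG := h.isRidge_inter hij.1 hij.2
    have hGi : polyFace u i ∩ polyFace u j ⊆ polyFace u i := Set.inter_subset_left
    have hGj : polyFace u i ∩ polyFace u j ⊆ polyFace u j := Set.inter_subset_right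
    obtain ⟨a, b, hab, ha, hb, hr⟩ := hridge _ hG
    unfold ReflectsFacets
    by_cases hia : i = a
    · subst hia
      by_cases hjb : j = b
      · subst hjb; exact hr
      · exact (h.not_three_facets hij.1 hab hjb hG hGi hGj hb).elim
    · by_cases hib : i = b
      · subst hib
        by_cases hja : j = a
        · subst hja; exact image_of_reflection_image hr
        · exact (h.not_three_facets hij.1 hia hja hG hGi hGj ha).elim
      · exact (h.not_three_facets hia hib hab hG hGi ha hb).elim
  refine ⟨fun G hG => ?_, h.isIsohedral hn hadj⟩
  obtain ⟨a, b, hab, ha, hb, hr⟩ := hridge G hG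
  refine ⟨?_, h.reflection_image_eq hadj _ hr⟩
  rw [h.span_ridge_eq hab hG ha hb]
  exact h.finrank_orthogonal_sub hab

/-! ### Integrals over a polyhedron as integrals of the gauge -/

/-- The positive part of the largest of the functionals `⟪u j, x⟫` with `j ∈ S`. -/
noncomputable def supPos (S : Finset ι) (u : ι → Space n) (x : Space n) : ℝ :=
  ((S.sup fun j => (⟪u j, x⟫_ℝ).toNNReal : NNReal) : ℝ)

lemma supPos_nonneg (S : Finset ι) (u : ι → Space n) (x : Space n) : 0 ≤ supPos S u x :=
  NNReal.coe_nonneg _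

lemma supPos_le_iff {S : Finset ι} {x : Space n} {s : ℝ} (hs : 0 ≤ s) :
    supPos S u x ≤ s ↔ ∀ j ∈ S, ⟪u j, x⟫_ℝ ≤ s := by
  lift s to NNReal using hs
  rw [supPos, NNReal.coe_le_coe, Finset.sup_le_iff]
  simp only [Real.toNNReal_le_iff_le_coe]

lemma supPos_lt_iff {S : Finset ι} {x : Space n} {s : ℝ} (hs : 0 < s) :
    supPos S u x < s ↔ ∀ j ∈ S, ⟪u j, x⟫_ℝ < s := by
  lift s to NNReal using hs.le
  rw [supPos, NNReal.coe_lt_coe, Finset.sup_lt_iff (by simpa using hs)]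
  refine forall₂_congr fun j _ => ?_
  rw [← NNReal.coe_lt_coe, Real.coe_toNNReal', max_lt_iff]
  exact and_iff_left hs

lemma inner_le_supPos {S : Finset ι} {j : ι} (hj : j ∈ S) (x : Space n) :
    ⟪u j, x⟫_ℝ ≤ supPos S u x :=
  (supPos_le_iff (supPos_nonneg _ _ _)).1 le_rfl j hj

lemma continuous_supPos (S : Finset ι) (u : ι → Space n) : Continuous (supPos S u) := by
  unfold supPos
  refine NNReal.continuous_coe.comp (Continuous.finset_sup_apply fun j _ => ?_)
  fun_prop

lemma IsFacetSystem.exists_norm_le (h : IsFacetSystem u P) :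
    ∃ R : ℝ, 0 < R ∧ ∀ x ∈ polyhedron u, ‖x‖ ≤ R := by
  obtain ⟨R, hR⟩ := isBounded_iff_forall_norm_le.1 h.bdd
  exact ⟨max R 1, by positivity, fun x hx => (hR x hx).trans (le_max_left _ _)⟩

section

variable [Fintype ι]

/-- The gauge of `polyhedron u` (for a bounded polyhedron): the largest of the functionals. -/
noncomputable def gaugeMax (u : ι → Space n) (x : Space n) : ℝ := supPos Finset.univ u x

lemma gaugeMax_le_iff {x : Space n} {s : ℝ} (hs : 0 ≤ s) :
    gaugeMax u x ≤ s ↔ ∀ j, ⟪u j, x⟫_ℝ ≤ s := by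
  simp [gaugeMax, supPos_le_iff hs]

lemma gaugeMax_nonneg (u : ι → Space n) (x : Space n) : 0 ≤ gaugeMax u x := supPos_nonneg _ _ _

lemma continuous_gaugeMax (u : ι → Space n) : Continuous (gaugeMax u) := continuous_supPos _ _

lemma mem_polyhedron_iff {x : Space n} : x ∈ polyhedron u ↔ gaugeMax u x ≤ 1 :=
  (gaugeMax_le_iff zero_le_one).symm

lemma setOf_gaugeMax_le {s : ℝ} (hs : 0 < s) :
    {x | gaugeMax u x ≤ s} = s • polyhedron u := by
  ext x
  rw [Set.mem_smul_set_iff_inv_smul_mem₀ hs.ne']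
  change gaugeMax u x ≤ s ↔ ∀ j, ⟪u j, s⁻¹ • x⟫_ℝ ≤ 1
  simp only [gaugeMax_le_iff hs.le, inner_smul_right, inv_mul_le_iff₀ hs, mul_one]

lemma norm_le_mul_gaugeMax {R : ℝ} (hR : ∀ x ∈ polyhedron u, ‖x‖ ≤ R) (x : Space n) :
    ‖x‖ ≤ R * gaugeMax u x := by
  rcases (gaugeMax_nonneg u x).eq_or_lt with h0 | h0
  · have hx : x = 0 := eq_zero_of_ray_subset (isBounded_iff_forall_norm_le.2 ⟨R, hR⟩) (p := 0)
      fun t ht j => by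
        have := (gaugeMax_le_iff (u := u) le_rfl).1 h0.symm.le j
        rw [zero_add, inner_smul_right]
        nlinarith
    rw [← h0, hx]; simp
  · have hx : x ∈ gaugeMax u x • polyhedron u := by
      rw [← setOf_gaugeMax_le h0]; exact le_refl (gaugeMax u x)
    obtain ⟨y, hy, hyx⟩ := hx
    have hyx : gaugeMax u x • y = x := hyx
    calc ‖x‖ = gaugeMax u x * ‖y‖ := by
          conv_lhs => rw [← hyx, norm_smul, Real.norm_of_nonneg h0.le]
      _ ≤ gaugeMax u x * R := by gcongr; exact hR y hy
      _ = _ := mul_comm _ _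

/-- The integral of a homogeneous function over a polyhedron, written as an integral over the whole
space of a weight that depends Lipschitz continuously on the inequalities. -/
lemma setIntegral_polyhedron_eq (hb : Bornology.IsBounded (polyhedron u)) {g : Space n → ℝ}
    (hg : Continuous g) {d : ℕ} (hgd : ∀ s : ℝ, 0 < s → ∀ x, g (s • x) = s ^ d * g x) :
    ∫ x in polyhedron u, g x =
      ((n : ℝ) + d + 1) * ∫ x, g x * max 0 (1 - gaugeMax u x) := by
  have hK : IsCompact (polyhedron u) :=
    Metric.isCompact_of_isClosed_isBounded (isClosed_polyhedron u) hb
  set A : Set (Space n × ℝ) := {p | gaugeMax u p.1 ≤ p.2 ∧ 0 < p.2 ∧ p.2 ≤ 1} with hA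
  have hNc := continuous_gaugeMax u
  have hAm : MeasurableSet A := by
    refine (measurableSet_le (hNc.comp continuous_fst).measurable measurable_snd).inter
      ((measurableSet_lt measurable_const measurable_snd).inter
        (measurableSet_le measurable_snd measurable_const))
  set H : Space n × ℝ → ℝ := A.indicator fun p => g p.1 with hH
  have hHint : MeasureTheory.Integrable H
      (MeasureTheory.volume.prod MeasureTheory.volume) := by
    rw [hH, MeasureTheory.integrable_indicator_iff hAm]
    have hsub : A ⊆ polyhedron u ×ˢ Set.Icc (0 : ℝ) 1 := by
      rintro ⟨x, s⟩ ⟨h1, h2, h3⟩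
      exact ⟨mem_polyhedron_iff.2 (h1.trans h3), h2.le, h3⟩
    refine MeasureTheory.IntegrableOn.mono_set ?_ hsub
    exact (hg.comp continuous_fst).continuousOn.integrableOn_compact (hK.prod isCompact_Icc)
  have h1 : ∀ x, ∫ s, H (x, s) = g x * max 0 (1 - gaugeMax u x) := by
    intro x
    have hN := gaugeMax_nonneg u x
    have : (fun s => H (x, s)) =ᵐ[MeasureTheory.volume]
        (Set.Ioc (gaugeMax u x) 1).indicator fun _ => g x := by
      have hne : ∀ᵐ s : ℝ, s ≠ gaugeMax u x := by
        simp [MeasureTheory.ae_iff]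
      filter_upwards [hne] with s hs
      by_cases hsA : s ∈ Set.Ioc (gaugeMax u x) 1
      · rw [Set.indicator_of_mem hsA, hH, Set.indicator_of_mem]
        exact ⟨hsA.1.le, hN.trans_lt hsA.1, hsA.2⟩
      · rw [Set.indicator_of_notMem hsA, hH, Set.indicator_of_notMem]
        rintro ⟨h1, -, h3⟩
        exact hsA ⟨lt_of_le_of_ne h1 (Ne.symm hs), h3⟩
    rw [MeasureTheory.integral_congr_ae this,
      MeasureTheory.integral_indicator measurableSet_Ioc, MeasureTheory.setIntegral_const,
      smul_eq_mul, mul_comm, Real.volume_real_Ioc, max_comm]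
  have h2 : ∀ s, ∫ x, H (x, s) =
      (Set.Ioc (0 : ℝ) 1).indicator (fun s => s ^ (n + d) * ∫ x in polyhedron u, g x) s := by
    intro s
    by_cases hs : s ∈ Set.Ioc (0 : ℝ) 1
    · rw [Set.indicator_of_mem hs]
      have hHs : (fun x => H (x, s)) = (s • polyhedron u).indicator g := by
        ext x
        rw [← setOf_gaugeMax_le hs.1]
        by_cases hx : gaugeMax u x ≤ s
        · rw [Set.indicator_of_mem (show x ∈ {x | gaugeMax u x ≤ s} from hx), hH,
            Set.indicator_of_mem]
          exact ⟨hx, hs⟩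
        · rw [Set.indicator_of_notMem (show x ∉ {x | gaugeMax u x ≤ s} from hx), hH,
            Set.indicator_of_notMem]
          exact fun h => hx h.1
      rw [hHs, MeasureTheory.integral_indicator ((hK.smul s).isClosed.measurableSet)]
      have h3 := MeasureTheory.Measure.setIntegral_comp_smul_of_pos MeasureTheory.volume g
        (polyhedron u) hs.1
      simp only [hgd s hs.1] at h3
      rw [MeasureTheory.integral_const_mul, finrank_euclideanSpace_fin, smul_eq_mul,
        eq_inv_mul_iff_mul_eq₀ (pow_ne_zero _ hs.1.ne')] at h3
      rw [← h3, pow_add]; ring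
    · rw [Set.indicator_of_notMem hs]
      have hHs : (fun x => H (x, s)) = 0 := by
        ext x
        rw [hH, Set.indicator_of_notMem]
        · rfl
        · exact fun h => hs h.2
      rw [hHs]; simp
  have h3 := MeasureTheory.integral_integral_swap (f := fun x s => H (x, s)) hHint
  simp only [h1, h2] at h3
  rw [MeasureTheory.integral_indicator measurableSet_Ioc, MeasureTheory.integral_mul_const,
    ← intervalIntegral.integral_of_le zero_le_one, integral_pow] at h3
  rw [h3]
  have : ((n : ℝ) + d + 1) ≠ 0 := by positivity
  push_cast
  field_simp
  simp

end

/-! ### The derivative of such an integral when one inequality is perturbed -/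

open Classical in
/-- The system in which the functional `u i` is replaced by `u i + t • v`. -/
noncomputable def perturb (u : ι → Space n) (i : ι) (v : Space n) (t : ℝ) : ι → Space n :=
  Function.update u i (u i + t • v)

lemma perturb_zero (u : ι → Space n) (i : ι) (v : Space n) : perturb u i v 0 = u := by
  simp [perturb]

section

variable [Fintype ι]

open Classical in
lemma gaugeMax_perturb (u : ι → Space n) (i : ι) (v : Space n) (t : ℝ) (x : Space n) :
    gaugeMax (perturb u i v t) x =
      max (supPos (Finset.univ.erase i) u x) (⟪u i, x⟫_ℝ + t * ⟪v, x⟫_ℝ) := by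
  have h1 : supPos (Finset.univ.erase i) (perturb u i v t) x =
      supPos (Finset.univ.erase i) u x := by
    unfold supPos
    congr 1
    refine Finset.sup_congr rfl fun j hj => ?_
    rw [perturb, Function.update_of_ne (Finset.ne_of_mem_erase hj)]
  rw [← h1]
  have h0 : 0 ≤ supPos (Finset.univ.erase i) (perturb u i v t) x := supPos_nonneg _ _ _
  rw [gaugeMax]
  conv_lhs => rw [← Finset.insert_erase (Finset.mem_univ i), supPos, Finset.sup_insert]
  rw [NNReal.coe_max, Real.coe_toNNReal', max_comm]
  change max (supPos (Finset.univ.erase i) (perturb u i v t) x) _ = _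
  rw [perturb, Function.update_self, inner_add_left, real_inner_smul_left, ← perturb,
    max_comm _ (0 : ℝ), ← max_assoc, max_eq_left h0]

lemma abs_gaugeMax_perturb_sub_le (u : ι → Space n) (i : ι) (v : Space n) (s t : ℝ) (x : Space n) :
    |gaugeMax (perturb u i v s) x - gaugeMax (perturb u i v t) x| ≤ |s - t| * |⟪v, x⟫_ℝ| := by
  classical
  rw [gaugeMax_perturb, gaugeMax_perturb, max_comm _ (⟪u i, x⟫_ℝ + s * ⟪v, x⟫_ℝ),
    max_comm _ (⟪u i, x⟫_ℝ + t * ⟪v, x⟫_ℝ), ← abs_mul]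
  refine (abs_max_sub_max_le_abs _ _ _).trans (le_of_eq ?_)
  congr 1; ring

lemma abs_gaugeMax_perturb_sub_le' {R : ℝ} (hR : ∀ x ∈ polyhedron u, ‖x‖ ≤ R) (i : ι)
    (v : Space n) (t : ℝ) (x : Space n) :
    |gaugeMax (perturb u i v t) x - gaugeMax u x| ≤ |t| * (‖v‖ * R) * gaugeMax u x := by
  have h := abs_gaugeMax_perturb_sub_le u i v t 0 x
  rw [perturb_zero, sub_zero] at h
  calc _ ≤ |t| * |⟪v, x⟫_ℝ| := h
    _ ≤ |t| * (‖v‖ * (R * gaugeMax u x)) := by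
        gcongr
        exact (abs_real_inner_le_norm v x).trans
          (mul_le_mul_of_nonneg_left (norm_le_mul_gaugeMax hR x) (norm_nonneg v))
    _ = _ := by ring

/-- For small `t` the perturbed gauge is at least half of the original one. -/
lemma gaugeMax_le_two_mul {R : ℝ} (hR : ∀ x ∈ polyhedron u, ‖x‖ ≤ R) (i : ι)
    (v : Space n) {t : ℝ} (ht : |t| * (‖v‖ * R) ≤ 1 / 2) (x : Space n) :
    gaugeMax u x ≤ 2 * gaugeMax (perturb u i v t) x := by
  have h1 := (abs_le.1 (abs_gaugeMax_perturb_sub_le' hR i v t x)).1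
  have h2 := gaugeMax_nonneg u x
  nlinarith

lemma eventually_abs_mul_le (B : ℝ) {ε : ℝ} (hε : 0 < ε) :
    ∀ᶠ t : ℝ in nhds 0, |t| * B ≤ ε := by
  have : Filter.Tendsto (fun t : ℝ => |t| * B) (nhds 0) (nhds 0) :=
    (by fun_prop : Continuous fun t : ℝ => |t| * B).tendsto' 0 0 (by simp)
  filter_upwards [this.eventually_lt_const hε] with t ht using ht.le

lemma hasDerivAt_tent {M a b : ℝ} (hMa : M ≠ a) (ha1 : a ≠ 1) :
    HasDerivAt (fun t : ℝ => max 0 (1 - max M (a + t * b)))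
      (if M < a ∧ a < 1 then -b else 0) 0 := by
  have hlim : Filter.Tendsto (fun t : ℝ => a + t * b) (nhds 0) (nhds a) :=
    (by fun_prop : Continuous fun t : ℝ => a + t * b).tendsto' 0 a (by simp)
  rcases hMa.lt_or_gt with h | h
  · rcases ha1.lt_or_gt with h1 | h1
    · rw [if_pos ⟨h, h1⟩]
      have : HasDerivAt (fun t : ℝ => 1 - (a + t * b)) (-b) 0 := by
        simpa using (((hasDerivAt_id (0 : ℝ)).mul_const b).const_add a).const_sub 1
      refine this.congr_of_eventuallyEq ?_
      filter_upwards [hlim.eventually_const_lt h, hlim.eventually_lt_const h1] with t h2 h3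
      rw [max_eq_right h2.le, max_eq_right (by linarith)]
    · rw [if_neg (by rintro ⟨-, h2⟩; linarith)]
      refine (hasDerivAt_const (0 : ℝ) (0 : ℝ)).congr_of_eventuallyEq ?_
      filter_upwards [hlim.eventually_const_lt h, hlim.eventually_const_lt h1] with t h2 h3
      rw [max_eq_right h2.le, max_eq_left (by linarith)]
  · rw [if_neg (by rintro ⟨h2, -⟩; linarith)]
    refine (hasDerivAt_const (0 : ℝ) (max 0 (1 - M))).congr_of_eventuallyEq ?_
    filter_upwards [hlim.eventually_lt_const h] with t h2
    rw [max_eq_left h2.le]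

lemma ae_inner_ne {v : Space n} (hv : v ≠ 0) (r : ℝ) :
    ∀ᵐ x : Space n, ⟪v, x⟫_ℝ ≠ r := by
  rw [MeasureTheory.ae_iff]
  simp only [ne_eq, not_not]
  by_cases hne : ∃ p : Space n, ⟪v, p⟫_ℝ = r
  · obtain ⟨p, hp⟩ := hne
    have hset : {x : Space n | ⟪v, x⟫_ℝ = r} = (AffineSubspace.mk' p (ℝ ∙ v)ᗮ : Set (Space n)) := by
      ext x
      rw [SetLike.mem_coe, AffineSubspace.mem_mk', vsub_eq_sub,
        Submodule.mem_orthogonal_singleton_iff_inner_right, inner_sub_right, hp, sub_eq_zero]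
      rfl
    rw [hset]
    refine MeasureTheory.Measure.addHaar_affineSubspace _ _ fun htop => ?_
    have h1 : p + v ∈ AffineSubspace.mk' p (ℝ ∙ v)ᗮ := htop ▸ AffineSubspace.mem_top ℝ _ _
    rw [AffineSubspace.mem_mk', vsub_eq_sub, add_sub_cancel_left,
      Submodule.mem_orthogonal_singleton_iff_inner_right] at h1
    exact hv (inner_self_eq_zero.1 h1)
  · push Not at hne
    simp [hne]

open Classical in
lemma IsFacetSystem.ae_hasDerivAt_tent (h : IsFacetSystem u P) (i : ι) (v : Space n) :
    ∀ᵐ x : Space n, HasDerivAt (fun t => max 0 (1 - gaugeMax (perturb u i v t) x))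
      ((pyramid u i).indicator (fun x => -⟪v, x⟫_ℝ) x) 0 := by
  have h1 : ∀ᵐ x : Space n, ∀ j, j ≠ i → ⟪u i - u j, x⟫_ℝ ≠ 0 := by
    rw [MeasureTheory.ae_all_iff]
    intro j
    by_cases hj : j = i
    · simp [hj]
    · filter_upwards [ae_inner_ne (sub_ne_zero.2 (h.ne (Ne.symm hj))) 0] with x hx _ using hx
  filter_upwards [h1, ae_inner_ne (h.ne_zero i) 0, ae_inner_ne (h.ne_zero i) 1] with x hx hx0 hx1
  have hxj : ∀ j, j ≠ i → ⟪u j, x⟫_ℝ ≠ ⟪u i, x⟫_ℝ := by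
    intro j hj he
    apply hx j hj
    rw [inner_sub_left, he, sub_self]
  set M := supPos (Finset.univ.erase i) u x with hM
  set a := ⟪u i, x⟫_ℝ with ha
  have hM0 : 0 ≤ M := supPos_nonneg _ _ _
  have hMlt : M < a ↔ 0 < a ∧ ∀ j, j ≠ i → ⟪u j, x⟫_ℝ < a := by
    constructor
    · intro hlt
      refine ⟨hM0.trans_lt hlt, fun j hj => ?_⟩
      exact (inner_le_supPos (Finset.mem_erase.2 ⟨hj, Finset.mem_univ _⟩) x).trans_lt hlt
    · rintro ⟨h0, h1⟩
      exact (supPos_lt_iff h0).2 fun j hj => h1 j (Finset.ne_of_mem_erase hj)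
  have hMa : M ≠ a := by
    intro he
    have h0 : 0 < a := lt_of_le_of_ne (he ▸ hM0) (Ne.symm hx0)
    have : M < a := hMlt.2 ⟨h0, fun j hj => lt_of_le_of_ne
      (he ▸ inner_le_supPos (Finset.mem_erase.2 ⟨hj, Finset.mem_univ _⟩) x) (hxj j hj)⟩
    exact this.ne he
  simp only [gaugeMax_perturb]
  convert hasDerivAt_tent (b := ⟪v, x⟫_ℝ) hMa hx1 using 1
  by_cases hp : x ∈ pyramid u i
  · rw [Set.indicator_of_mem hp, if_pos]
    refine ⟨hMlt.2 ⟨?_, fun j hj => lt_of_le_of_ne (hp.2 j) (hxj j hj)⟩,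
      lt_of_le_of_ne (hp.1 i) hx1⟩
    obtain ⟨s, hs0, -, y, hy, hyx⟩ := h.mem_pyramid_iff.1 hp
    refine lt_of_le_of_ne ?_ (Ne.symm hx0)
    rw [ha, ← hyx, inner_smul_right, hy.2, mul_one]
    exact hs0
  · rw [Set.indicator_of_notMem hp, if_neg]
    rintro ⟨h2, h3⟩
    have h4 : ∀ j, ⟪u j, x⟫_ℝ ≤ a := by
      intro j
      by_cases hj : j = i
      · rw [hj]
      · exact ((hMlt.1 h2).2 j hj).le
    exact hp ⟨fun j => (h4 j).trans h3.le, h4⟩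

lemma norm_le_of_mem_polyhedron_perturb {R : ℝ} (hR0 : 0 < R)
    (hR : ∀ x ∈ polyhedron u, ‖x‖ ≤ R) (i : ι)
    (v : Space n) {t : ℝ} (ht : |t| * (‖v‖ * R) ≤ 1 / 2) {x : Space n}
    (hx : gaugeMax (perturb u i v t) x ≤ 1) : ‖x‖ ≤ 2 * R := by
  have h1 := gaugeMax_le_two_mul hR i v ht x
  have h2 := norm_le_mul_gaugeMax hR x
  nlinarith

lemma IsFacetSystem.eventually_isBounded (h : IsFacetSystem u P) (i : ι) (v : Space n) :
    ∀ᶠ t : ℝ in nhds 0, Bornology.IsBounded (polyhedron (perturb u i v t)) := by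
  obtain ⟨R, hR0, hR⟩ := h.exists_norm_le
  filter_upwards [eventually_abs_mul_le (‖v‖ * R) (one_half_pos)] with t ht
  exact isBounded_iff_forall_norm_le.2 ⟨2 * R, fun x hx =>
    norm_le_of_mem_polyhedron_perturb hR0 hR i v ht (mem_polyhedron_iff.1 hx)⟩

/-- First variation: the derivative of the integral of a homogeneous function when the `i`-th
facet hyperplane is moved. -/
lemma IsFacetSystem.hasDerivAt_setIntegral (h : IsFacetSystem u P) (i : ι) (v : Space n)
    {g : Space n → ℝ} (hg : Continuous g) {d : ℕ}
    (hgd : ∀ s : ℝ, 0 < s → ∀ x, g (s • x) = s ^ d * g x) :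
    HasDerivAt (fun t => ∫ x in polyhedron (perturb u i v t), g x)
      (-(((n : ℝ) + d + 1) * ∫ x in pyramid u i, g x * ⟪v, x⟫_ℝ)) 0 := by
  obtain ⟨R, hR0, hR⟩ := h.exists_norm_le
  set F : ℝ → Space n → ℝ := fun t x => g x * max 0 (1 - gaugeMax (perturb u i v t) x) with hF
  have hFc : ∀ t, Continuous (F t) := by
    intro t
    have := continuous_gaugeMax (perturb u i v t)
    fun_prop
  have hmain : HasDerivAt (fun t => ∫ x, F t x)
      (∫ x, (pyramid u i).indicator (fun x => -(g x * ⟪v, x⟫_ℝ)) x) 0 := by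
    have hF0 : ∀ t : ℝ, |t| * (‖v‖ * R) ≤ 1 / 2 → ∀ x, x ∉ Metric.closedBall (0 : Space n) (2 * R) →
        F t x = 0 := by
      intro t ht x hx
      have : 1 ≤ gaugeMax (perturb u i v t) x := by
        by_contra hlt
        exact hx (mem_closedBall_zero_iff.2
          (norm_le_of_mem_polyhedron_perturb hR0 hR i v ht (not_le.1 hlt).le))
      simp only [hF]
      rw [max_eq_left (by linarith), mul_zero]
    have hball : IsCompact (Metric.closedBall (0 : Space n) (2 * R)) := isCompact_closedBall _ _
    refine (hasDerivAt_integral_of_dominated_loc_of_lip (𝕜 := ℝ)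
      (bound := (Metric.closedBall (0 : Space n) (2 * R)).indicator fun x => |g x * ⟪v, x⟫_ℝ|)
      (s := {t : ℝ | |t| * (‖v‖ * R) ≤ 1 / 2})
      (eventually_abs_mul_le (‖v‖ * R) one_half_pos)
      (Filter.Eventually.of_forall fun t => (hFc t).aestronglyMeasurable) ?_ ?_ ?_ ?_ ?_).2
    · exact (hFc 0).integrable_of_hasCompactSupport
        (HasCompactSupport.intro hball (hF0 0 (by simp)))
    · refine MeasureTheory.AEStronglyMeasurable.indicator ?_ (isClosed_pyramid u i).measurableSet
      exact (by fun_prop : Continuous fun x => -(g x * ⟪v, x⟫_ℝ)).aestronglyMeasurable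
    · refine Filter.Eventually.of_forall fun x => ?_
      refine LipschitzOnWith.of_dist_le_mul fun s hs t ht => ?_
      rw [Real.dist_eq, Real.dist_eq]
      by_cases hx : x ∈ Metric.closedBall (0 : Space n) (2 * R)
      · rw [Set.indicator_of_mem hx, Real.coe_nnabs, abs_abs]
        simp only [hF]
        rw [← mul_sub, abs_mul, abs_mul, mul_assoc, mul_comm |⟪v, x⟫_ℝ|]
        gcongr
        rw [max_comm 0, max_comm 0]
        refine (abs_max_sub_max_le_abs _ _ _).trans ?_
        rw [sub_sub_sub_cancel_left, abs_sub_comm]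
        exact abs_gaugeMax_perturb_sub_le u i v s t x
      · rw [hF0 s hs x hx, hF0 t ht x hx, sub_self, abs_zero]
        positivity
    · rw [MeasureTheory.integrable_indicator_iff hball.isClosed.measurableSet]
      exact (by fun_prop : Continuous fun x => |g x * ⟪v, x⟫_ℝ|).continuousOn.integrableOn_compact
        hball
    · filter_upwards [h.ae_hasDerivAt_tent i v] with x hx
      refine (hx.const_mul (g x)).congr_deriv ?_
      by_cases hp : x ∈ pyramid u i
      · rw [Set.indicator_of_mem hp, Set.indicator_of_mem hp]; ring
      · rw [Set.indicator_of_notMem hp, Set.indicator_of_notMem hp, mul_zero]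
  rw [MeasureTheory.integral_indicator (isClosed_pyramid u i).measurableSet,
    MeasureTheory.integral_neg] at hmain
  have h2 := hmain.const_mul ((n : ℝ) + d + 1)
  rw [mul_neg] at h2
  refine h2.congr_of_eventuallyEq ?_
  filter_upwards [h.eventually_isBounded i v] with t ht
  exact setIntegral_polyhedron_eq ht hg hgd

end

/-! ### Mean and covariance of the uniform distribution -/

lemma integral_uniformDist (K : Set (Space n)) (g : Space n → ℝ) :
    ∫ x, g x ∂(uniformDist K) =
      (MeasureTheory.volume.real K)⁻¹ * ∫ x in K, g x := by
  rw [uniformDist, ProbabilityTheory.cond, MeasureTheory.integral_smul_measure, smul_eq_mul,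
    ENNReal.toReal_inv]
  rfl

lemma volume_real_eq_integral (K : Set (Space n)) :
    MeasureTheory.volume.real K = ∫ _ in K, (1 : ℝ) := by
  simp

lemma integrable_uniformDist {K : Set (Space n)} (hK : IsCompact K)
    (hK0 : MeasureTheory.volume K ≠ 0) : MeasureTheory.Integrable (fun x => x) (uniformDist K) := by
  rw [uniformDist, ProbabilityTheory.cond]
  refine MeasureTheory.Integrable.smul_measure ?_ (ENNReal.inv_ne_top.2 hK0)
  exact continuous_id.continuousOn.integrableOn_compact hK

lemma centroid_apply {K : Set (Space n)} (hK : IsCompact K)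
    (hK0 : MeasureTheory.volume K ≠ 0) (j : Fin n) :
    centroid K j = (MeasureTheory.volume.real K)⁻¹ * ∫ x in K, x j := by
  rw [← integral_uniformDist]
  exact ((EuclideanSpace.proj j : Space n →L[ℝ] ℝ).integral_comp_comm
    (integrable_uniformDist hK hK0)).symm

lemma covMatrix_apply {K : Set (Space n)} (hK : IsCompact K)
    (hK0 : MeasureTheory.volume K ≠ 0) (j k : Fin n) :
    covMatrix K j k = (MeasureTheory.volume.real K)⁻¹ * (∫ x in K, x j * x k) -
      ((MeasureTheory.volume.real K)⁻¹ * ∫ x in K, x j) *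
        ((MeasureTheory.volume.real K)⁻¹ * ∫ x in K, x k) := by
  rw [covMatrix, Matrix.of_apply, centroid_apply hK hK0, centroid_apply hK hK0,
    integral_uniformDist]

lemma volume_ne_zero_of_interior {K : Set (Space n)} (hK : (interior K).Nonempty) :
    MeasureTheory.volume K ≠ 0 := fun h0 =>
  (isOpen_interior.measure_pos MeasureTheory.volume hK).ne'
    (MeasureTheory.measure_mono_null interior_subset h0)

/-- The centroid of a convex body lies in its interior. -/
lemma zero_mem_interior_of_centroid_eq_zero {K : Set (Space n)} (hKc : IsCompact K)
    (hKconv : Convex ℝ K) (hKi : (interior K).Nonempty) (hcen : centroid K = 0) :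
    (0 : Space n) ∈ interior K := by
  by_contra h0
  have hK0 := volume_ne_zero_of_interior hKi
  obtain ⟨f, hf⟩ := geometric_hahn_banach_open_point hKconv.interior isOpen_interior h0
  simp only [map_zero] at hf
  have hfK : ∀ x ∈ K, 0 ≤ -f x := by
    intro x hx
    have hcl : K ⊆ closure (interior K) := by
      rw [hKconv.closure_interior_eq_closure_of_nonempty_interior hKi]; exact subset_closure
    have : closure (interior K) ⊆ {x | f x ≤ 0} :=
      closure_minimal (fun x hx => (hf x hx).le) (isClosed_le f.continuous continuous_const)
    have := this (hcl hx)
    exact neg_nonneg.2 this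
  have hint : ∫ x in K, -f x = 0 := by
    have h1 := f.integral_comp_comm (integrable_uniformDist hKc hK0)
    have h2 : (∫ x, x ∂(uniformDist K)) = 0 := hcen
    rw [h2, map_zero, integral_uniformDist] at h1
    have h3 : (MeasureTheory.volume.real K)⁻¹ ≠ 0 :=
      inv_ne_zero ((MeasureTheory.measureReal_ne_zero_iff hKc.measure_lt_top.ne).2 hK0)
    rw [MeasureTheory.integral_neg, (mul_eq_zero.1 h1).resolve_left h3, neg_zero]
  have hae := (MeasureTheory.setIntegral_eq_zero_iff_of_nonneg_ae
    (by filter_upwards [MeasureTheory.ae_restrict_mem hKc.isClosed.measurableSet] with x hx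
        using hfK x hx)
    (f.continuous.neg.continuousOn.integrableOn_compact hKc)).1 hint
  have hae' := MeasureTheory.ae_restrict_of_ae_restrict_of_subset interior_subset hae
  have hfalse : ∀ᵐ x ∂(MeasureTheory.volume.restrict (interior K)), False := by
    filter_upwards [hae', MeasureTheory.ae_restrict_mem isOpen_interior.measurableSet] with x h1 h2
    have h3 := hf x h2
    have h4 : -f x = 0 := h1
    linarith
  rw [Filter.eventually_false_iff_eq_bot, MeasureTheory.ae_eq_bot,
    MeasureTheory.Measure.restrict_eq_zero] at hfalse
  exact (isOpen_interior.measure_pos MeasureTheory.volume hKi).ne' hfalse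

/-! ### The derivative of the isotropic constant -/

/-- The derivative of the determinant at the identity matrix is the trace. -/
lemma hasDerivAt_det_of_eq_one {A : ℝ → Matrix (Fin n) (Fin n) ℝ} {A' : Matrix (Fin n) (Fin n) ℝ}
    {t₀ : ℝ} (hA : ∀ j k, HasDerivAt (fun t => A t j k) (A' j k) t₀) (h1 : A t₀ = 1) :
    HasDerivAt (fun t => (A t).det) A'.trace t₀ := by
  have h2 : HasDerivAt (fun t => ∑ σ : Equiv.Perm (Fin n), (Equiv.Perm.sign σ : ℤ) *
      ∏ j, A t (σ j) j) (∑ σ : Equiv.Perm (Fin n), (Equiv.Perm.sign σ : ℤ) *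
        ∑ k, (∏ j ∈ Finset.univ.erase k, A t₀ (σ j) j) • A' (σ k) k) t₀ :=
    HasDerivAt.fun_sum fun σ _ =>
      (HasDerivAt.fun_finsetProd fun k _ => hA (σ k) k).const_mul _
  simp only [Matrix.det_apply']
  refine h2.congr_deriv ?_
  simp only [Finset.mul_sum]
  rw [Finset.sum_comm, Matrix.trace]
  refine Finset.sum_congr rfl fun k _ => ?_
  -- the `k`-th summand is the determinant of the identity with column `k` replaced
  have h3 : ((1 : Matrix (Fin n) (Fin n) ℝ).updateCol k fun r => A' r k).det = A' k k := by
    rw [← Matrix.cramer_apply, Matrix.cramer_one]; rfl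
  rw [Matrix.diag_apply, ← h3, Matrix.det_apply']
  refine Finset.sum_congr rfl fun σ _ => ?_
  congr 1
  rw [← Finset.mul_prod_erase _ _ (Finset.mem_univ k), Matrix.updateCol_self, smul_eq_mul, mul_comm,
    h1]
  congr 1
  refine Finset.prod_congr rfl fun j hj => ?_
  rw [Matrix.updateCol_ne (Finset.ne_of_mem_erase hj)]

lemma HasDerivAt.isotropic_quotient {A : ℝ → Matrix (Fin n) (Fin n) ℝ} {V : ℝ → ℝ}
    {M : ℝ → Fin n → Fin n → ℝ} {B : ℝ → Fin n → ℝ} {V' : ℝ} {M' : Fin n → Fin n → ℝ}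
    {B' : Fin n → ℝ} (hV : HasDerivAt V V' 0) (hM : ∀ j k, HasDerivAt (fun t => M t j k) (M' j k) 0)
    (hB : ∀ j, HasDerivAt (fun t => B t j) (B' j) 0) (hV0 : V 0 ≠ 0)
    (hB0 : ∀ j, B 0 j = 0) (hA0 : A 0 = 1)
    (hA : ∀ t j k, A t j k = (V t)⁻¹ * M t j k - ((V t)⁻¹ * B t j) * ((V t)⁻¹ * B t k)) :
    HasDerivAt (fun t => (A t).det / V t ^ 2)
      ((V 0 ^ 3)⁻¹ * (∑ j, M' j j - ((n : ℝ) + 2) * V')) 0 := by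
  have hVi : HasDerivAt (fun t => (V t)⁻¹) (-V' / V 0 ^ 2) 0 := hV.fun_inv hV0
  have hM0 : ∀ j, M 0 j j = V 0 := by
    intro j
    have := hA 0 j j
    rw [hA0, hB0, Matrix.one_apply_eq, mul_zero, mul_zero, sub_zero] at this
    field_simp at this
    linarith
  have hdet := hasDerivAt_det_of_eq_one (A := A)
    (A' := Matrix.of fun j k => -V' / V 0 ^ 2 * M 0 j k + (V 0)⁻¹ * M' j k) (t₀ := 0)
    (fun j k => by
      simp only [hA]
      refine ((hVi.fun_mul (hM j k)).fun_sub
        ((hVi.fun_mul (hB j)).fun_mul (hVi.fun_mul (hB k)))).congr_deriv ?_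
      rw [hB0, hB0, Matrix.of_apply]
      ring) hA0
  refine (hdet.fun_div (hV.fun_pow 2) (pow_ne_zero 2 hV0)).congr_deriv ?_
  rw [hA0, Matrix.det_one, Matrix.trace]
  simp only [Matrix.diag_apply, Matrix.of_apply, hM0]
  rw [Finset.sum_add_distrib, Finset.sum_const, ← Finset.mul_sum, Finset.card_univ,
    Fintype.card_fin, nsmul_eq_mul]
  field_simp
  push_cast
  ring

/-! ### The first-order condition at a local extremum -/

lemma smul_mem_polyhedron_of_mul_gaugeMax_le [Fintype ι] {s : ℝ} (hs : 0 ≤ s) {x : Space n}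
    (hx : s * gaugeMax u x ≤ 1) : s • x ∈ polyhedron u := by
  intro j
  rw [inner_smul_right]
  exact (mul_le_mul_of_nonneg_left (inner_le_supPos (Finset.mem_univ j) x) hs).trans hx

lemma hausdorffDist_perturb_le [Fintype ι] {R : ℝ} (hR0 : 0 < R)
    (hR : ∀ x ∈ polyhedron u, ‖x‖ ≤ R) (i : ι) (v : Space n) {t : ℝ}
    (ht : |t| * (‖v‖ * R) ≤ 1 / 2) :
    Metric.hausdorffDist (polyhedron (perturb u i v t)) (polyhedron u) ≤
      |t| * (‖v‖ * R) * (2 * R) := by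
  set δ := |t| * (‖v‖ * R) with hδ
  have hδ0 : 0 ≤ δ := by positivity
  have hdist : ∀ x : Space n, ‖x‖ ≤ 2 * R → dist x ((1 - δ) • x) ≤ δ * (2 * R) := by
    intro x hx
    have : x - (1 - δ) • x = δ • x := by module
    rw [dist_eq_norm, this, norm_smul, Real.norm_of_nonneg hδ0]
    gcongr
  have hN : ∀ x, |gaugeMax (perturb u i v t) x - gaugeMax u x| ≤ δ * gaugeMax u x :=
    abs_gaugeMax_perturb_sub_le' hR i v t
  refine Metric.hausdorffDist_le_of_mem_dist (by positivity) (fun x hx => ?_) (fun x hx => ?_)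
  · have hx1 := mem_polyhedron_iff.1 hx
    refine ⟨(1 - δ) • x, smul_mem_polyhedron_of_mul_gaugeMax_le (by linarith) ?_,
      hdist x (norm_le_of_mem_polyhedron_perturb hR0 hR i v ht hx1)⟩
    have := (abs_le.1 (hN x)).1
    linarith
  · have hx1 := mem_polyhedron_iff.1 hx
    have h0 := gaugeMax_nonneg u x
    refine ⟨(1 - δ) • x, smul_mem_polyhedron_of_mul_gaugeMax_le (by linarith) ?_,
      hdist x ((hR x hx).trans (by linarith))⟩
    have h1 := (abs_le.1 (hN x)).2
    have h2 : gaugeMax (perturb u i v t) x ≤ 1 + δ := by nlinarith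
    nlinarith

open Classical in
/-- The perturbed polyhedron as a convex body. It is bounded for small `t`; where it is not, the
value `P` is a placeholder. -/
noncomputable def perturbBody (u : ι → Space n) (i : ι) (v : Space n) (P : ConvexBody (Space n))
    (t : ℝ) : ConvexBody (Space n) :=
  if hb : Bornology.IsBounded (polyhedron (perturb u i v t)) then
    ⟨polyhedron (perturb u i v t), convex_polyhedron _,
      Metric.isCompact_of_isClosed_isBounded (isClosed_polyhedron _) hb,
      ⟨0, zero_mem_polyhedron _⟩⟩
  else P

lemma coe_perturbBody (i : ι) (v : Space n) (P : ConvexBody (Space n)) {t : ℝ}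
    (hb : Bornology.IsBounded (polyhedron (perturb u i v t))) :
    (perturbBody u i v P t : Set (Space n)) = polyhedron (perturb u i v t) := by
  rw [perturbBody, dif_pos hb]; rfl

section

variable {P : ConvexBody (Space n)}

lemma IsFacetSystem.perturbBody_zero (h : IsFacetSystem u (P : Set (Space n))) (i : ι)
    (v : Space n) : perturbBody u i v P 0 = P := by
  apply SetLike.coe_injective
  rw [coe_perturbBody i v P (by rw [perturb_zero]; exact h.bdd), perturb_zero, h.eq]

lemma IsFacetSystem.tendsto_perturbBody [Fintype ι] (h : IsFacetSystem u (P : Set (Space n)))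
    (hn : n ≠ 0)
    (i : ι) (v : Space n) :
    Filter.Tendsto (perturbBody u i v P) (nhds 0)
      (nhdsWithin P {Q : ConvexBody (Space n) | IsPolytope (Q : Set (Space n)) ∧
        numFacets (Q : Set (Space n)) ≤ numFacets (P : Set (Space n))}) := by
  refine tendsto_nhdsWithin_iff.2 ⟨?_, ?_⟩
  · obtain ⟨R, hR0, hR⟩ := h.exists_norm_le
    have hlim : Filter.Tendsto (fun t : ℝ => |t| * (‖v‖ * R) * (2 * R)) (nhds 0) (nhds 0) :=
      (by fun_prop : Continuous fun t : ℝ => |t| * (‖v‖ * R) * (2 * R)).tendsto' 0 0 (by simp)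
    rw [tendsto_iff_dist_tendsto_zero]
    refine squeeze_zero' (Filter.Eventually.of_forall fun _ => dist_nonneg) ?_ hlim
    filter_upwards [h.eventually_isBounded i v, eventually_abs_mul_le (‖v‖ * R) one_half_pos]
      with t hb ht
    rw [← ConvexBody.hausdorffDist_coe, coe_perturbBody i v P hb, ← h.eq]
    exact hausdorffDist_perturb_le hR0 hR i v ht
  · filter_upwards [h.eventually_isBounded i v] with t hb
    refine ⟨?_, ?_⟩
    · rw [coe_perturbBody i v P hb]
      exact isPolytope_polyhedron hb
    · rw [coe_perturbBody i v P hb]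
      exact (numFacets_polyhedron_le hn _).trans h.card_le_numFacets

/-- The first-order condition of a local extremum: the derivative of the isotropic constant vanishes
when the hyperplane of one facet is moved. At an isotropic polytope it is, up to a positive factor,
the derivative of `∫ ‖x‖ ^ 2 - (n + 2) * vol`. -/
lemma IsFacetSystem.integral_pyramid_eq [Fintype ι] (h : IsFacetSystem u (P : Set (Space n)))
    (hn : n ≠ 0)
    (hiso : IsIsotropic (P : Set (Space n))) (hext : IsLocalExtremum P) (i : ι) (v : Space n) :
    ∫ x in pyramid u i, ‖x‖ ^ 2 * ⟪v, x⟫_ℝ =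
      (((n : ℝ) + 2) * (n + 1) / (n + 3)) * ∫ x in pyramid u i, ⟪v, x⟫_ℝ := by
  set Q : ℝ → Set (Space n) := fun t => polyhedron (perturb u i v t) with hQ
  have hQ0 : Q 0 = P := by rw [hQ]; simp only [perturb_zero]; exact h.eq
  have hQint : ∀ t, (interior (Q t)).Nonempty := fun t =>
    ⟨0, mem_interior_iff_mem_nhds.2 (polyhedron_mem_nhds_zero _)⟩
  have hQc : ∀ t, Bornology.IsBounded (Q t) → IsCompact (Q t) := fun t hb =>
    Metric.isCompact_of_isClosed_isBounded (isClosed_polyhedron _) hb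
  have hPc : IsCompact (Q 0) := hQ0 ▸ P.isCompact
  set V : ℝ → ℝ := fun t => ∫ _ in Q t, (1 : ℝ) with hVdef
  set B : ℝ → Fin n → ℝ := fun t j => ∫ x in Q t, x j with hBdef
  set M : ℝ → Fin n → Fin n → ℝ := fun t j k => ∫ x in Q t, x j * x k with hMdef
  have hV := h.hasDerivAt_setIntegral i v (g := fun _ => 1) continuous_const (d := 0) (by simp)
  have hB := fun j : Fin n => h.hasDerivAt_setIntegral i v (g := fun x => x j) (by fun_prop)
    (d := 1) (by simp)
  have hM := fun j k : Fin n => h.hasDerivAt_setIntegral i v (g := fun x => x j * x k) (by fun_prop)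
    (d := 2) (by intro s _ x; simp only [PiLp.smul_apply, smul_eq_mul]; ring)
  set A : ℝ → Matrix (Fin n) (Fin n) ℝ := fun t => Matrix.of fun j k =>
    (V t)⁻¹ * M t j k - ((V t)⁻¹ * B t j) * ((V t)⁻¹ * B t k) with hAdef
  have hAcov : ∀ t, Bornology.IsBounded (Q t) → covMatrix (Q t) = A t := by
    intro t hb
    ext j k
    rw [covMatrix_apply (hQc t hb) (volume_ne_zero_of_interior (hQint t)), volume_real_eq_integral]
    rfl
  have hV0 : V 0 ≠ 0 := by
    rw [hVdef]
    simp only [← volume_real_eq_integral]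
    exact (MeasureTheory.measureReal_ne_zero_iff hPc.measure_lt_top.ne).2
      (volume_ne_zero_of_interior (hQint 0))
  have hB0 : ∀ j, B 0 j = 0 := by
    intro j
    have h1 := centroid_apply hPc (volume_ne_zero_of_interior (hQint 0)) j
    rw [hQ0, hiso.1, ← hQ0, volume_real_eq_integral] at h1
    exact (mul_eq_zero.1 h1.symm).resolve_left (inv_ne_zero hV0)
  have hA0 : A 0 = 1 := by
    rw [← hAcov 0 hPc.isBounded, hQ0, hiso.2]
  have hD := HasDerivAt.isotropic_quotient (A := A) (V := V) (M := M) (B := B) hV hM hB hV0 hB0 hA0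
    (fun t j k => rfl)
  have hD0 : (A 0).det / V 0 ^ 2 ≠ 0 := by
    rw [hA0, Matrix.det_one]
    exact div_ne_zero one_ne_zero (pow_ne_zero 2 hV0)
  have hL := hD.rpow_const (p := 1 / (2 * (n : ℝ))) (Or.inl hD0)
  have hextr : IsLocalExtr
      ((fun K : ConvexBody (Space n) => isotropicConstant (K : Set (Space n))) ∘
        perturbBody u i v P) 0 := by
    refine IsExtrFilter.comp_tendsto (g := perturbBody u i v P) ?_ (h.tendsto_perturbBody hn i v)
    rw [h.perturbBody_zero]
    exact hext
  have hLeq : ((fun K : ConvexBody (Space n) => isotropicConstant (K : Set (Space n))) ∘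
      perturbBody u i v P) =ᶠ[nhds 0]
        fun t => ((A t).det / V t ^ 2) ^ (1 / (2 * (n : ℝ))) := by
    filter_upwards [h.eventually_isBounded i v] with t hb
    rw [Function.comp_apply, coe_perturbBody i v P hb, isotropicConstant, hAcov t hb,
      volume_real_eq_integral]
  have hzero := hextr.hasDerivAt_eq_zero (hL.congr_of_eventuallyEq hLeq)
  have hpow : ((A 0).det / V 0 ^ 2) ^ (1 / (2 * (n : ℝ)) - 1) ≠ 0 := by
    have : 0 < (A 0).det / V 0 ^ 2 := by
      rw [hA0, Matrix.det_one]; positivity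
    exact (Real.rpow_pos_of_pos this _).ne'
  have hexp : 1 / (2 * (n : ℝ)) ≠ 0 := by positivity
  have hkey := (mul_eq_zero.1 ((mul_eq_zero.1 ((mul_eq_zero.1 hzero).resolve_right
    hpow)).resolve_right hexp)).resolve_left (inv_ne_zero (pow_ne_zero 3 hV0))
  have hnorm : ∫ x in pyramid u i, ‖x‖ ^ 2 * ⟪v, x⟫_ℝ =
      ∑ j, ∫ x in pyramid u i, x j * x j * ⟪v, x⟫_ℝ := by
    rw [← MeasureTheory.integral_finsetSum]
    · congr 1
      ext x
      rw [EuclideanSpace.real_norm_sq_eq, Finset.sum_mul]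
      simp only [sq]
    · intro j _
      exact (by fun_prop : Continuous fun x : Space n =>
        x j * x j * ⟪v, x⟫_ℝ).continuousOn.integrableOn_compact (h.isCompact_pyramid i)
  simp only [one_mul, Finset.sum_neg_distrib, ← Finset.mul_sum, ← hnorm] at hkey
  push_cast at hkey
  have h3 : (n : ℝ) + 3 ≠ 0 := by positivity
  field_simp
  linarith

end

lemma IsFacetSystem.nonempty_index {S : Set (Space n)} (h : IsFacetSystem u S) (hn : n ≠ 0) :
    Nonempty ι := by
  by_contra hemp
  rw [not_nonempty_iff] at hemp
  have : NeZero n := ⟨hn⟩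
  have hz : (EuclideanSpace.single (0 : Fin n) (1 : ℝ)) = 0 :=
    eq_zero_of_ray_subset h.bdd (p := 0) fun t _ j => isEmptyElim j
  have := congrArg (fun x : Space n => x 0) hz
  simp at this

end PolytopeReflector

theorem theorem2p5 (n : ℕ) (P : ConvexBody (PolytopeReflector.Space n))
    (hP : PolytopeReflector.IsPolytope (P : Set (PolytopeReflector.Space n)))
    (hiso : PolytopeReflector.IsIsotropic (P : Set (PolytopeReflector.Space n)))
    (hext : PolytopeReflector.IsLocalExtremum P)
    (hrefl : ∀ G : Set (PolytopeReflector.Space n),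
      PolytopeReflector.IsRidge (P : Set (PolytopeReflector.Space n)) G →
        PolytopeReflector.IsAffineReflector (P : Set (PolytopeReflector.Space n)) G) :
    (∀ G : Set (PolytopeReflector.Space n),
      PolytopeReflector.IsRidge (P : Set (PolytopeReflector.Space n)) G →
        PolytopeReflector.IsSymmetricHyperplane (P : Set (PolytopeReflector.Space n))
          (Submodule.span ℝ G)) ∧
    PolytopeReflector.IsIsohedral (P : Set (PolytopeReflector.Space n)) := by
  open PolytopeReflector in
  rcases eq_or_ne n 0 with rfl | hn
  · -- in dimension `0` the only facet is the empty set, and there are no ridges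
    refine ⟨fun G hG => ?_, fun F F' hF hF' => ?_⟩
    · have h1 := hG.2
      have h2 := neg_one_le_dim G
      rw [h1] at h2
      norm_num at h2
    · have h1 : F = ∅ := eq_empty_of_dim_eq_neg_one (by simpa using hF.2)
      have h2 : F' = ∅ := eq_empty_of_dim_eq_neg_one (by simpa using hF'.2)
      subst h1 h2
      exact ⟨AffineIsometryEquiv.refl ℝ _, by simp, by simp⟩
  · have h0 := zero_mem_interior_of_centroid_eq_zero P.isCompact P.convex hP.2 hiso.1
    obtain ⟨J, h⟩ := exists_isFacetSystem hP h0
    have := h.nonempty_index hn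
    exact h.symmetric_and_isohedral hn (fun i v => h.integral_pyramid_eq hn hiso hext i v) hrefl
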